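/- Notation. For a contraction $A\in\mathbf L(X,Y)$ between complex Hilbert spaces put $D_A=(I-A^*A)^{1/2}$ and let $\mathfrak D_A$ be the closure of $\operatorname{ran} D_A$. A *choice sequence* is a sequence of contractions $\Gamma_0\in\mathbf L(\mathfrak M,\mathfrak N)$, $\Gamma_{n}\in\mathbf L(\mathfrak D_{\Gamma_{n-1}},\mathfrak D_{\Gamma_{n-1}^*})$, $n\ge1$ (a sequence that stops at a unitary $\Gamma_m$ is continued by zero operators on $\{0\}$); then $\{\Gamma_n^*\}$ is a choice sequence too. It is the sequence of *Schur parameters* of a function $\Theta:\mathbb D\to\mathbf L(\mathfrak M,\mathfrak N)$ if there are holomorphic contraction-valued functions $\Theta_n$ on $\mathbb D$ (the Schur iterates) with $\Theta_0=\Theta$, $\Theta_n(0)=\Gamma_n$ and $$\Theta_n(\lambda)=\Gamma_n+D_{\Gamma_n^*}\,\lambda\Theta_{n+1}(\lambda)\bigl(I+\Gamma_n^*\lambda\Theta_{n+1}(\lambda)\bigr)^{-1}D_{\Gamma_n},\qquad \lambda\in\mathbb D,\ n\ge0 .$$ Put $\mathbf J_{\Gamma_n}=\begin{bmatrix}\Gamma_n&D_{\Gamma_n^*}\\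 D_{\Gamma_n}&-\Gamma_n^*\end{bmatrix}$, acting from $\mathfrak D_{\Gamma_{n-1}}\oplus\mathfrak D_{\Gamma_n^*}$ to $\mathfrak D_{\Gamma_{n-1}^*}\oplus\mathfrak D_{\Gamma_n}$ (with $\mathfrak D_{\Gamma_{-1}}:=\mathfrak M$, $\mathfrak D_{\Gamma_{-1}^*}:=\mathfrak N$), and $$\mathfrak H_0=\bigoplus_{n\ge0}\bigl(\mathfrak D_{\Gamma_{2n}}\oplus\mathfrak D_{\Gamma_{2n+1}^*}\bigr),\qquad \widetilde{\mathfrak H}_0=\bigoplus_{n\ge0}\bigl(\mathfrak D_{\Gamma_{2n}^*}\oplus\mathfrak D_{\Gamma_{2n+1}}\bigr),$$ $$\mathcal V_0=\bigoplus_{n\ge0}\mathbf J_{\Gamma_{2n+1}}:\mathfrak H_0\to\widetilde{\mathfrak H}_0,\qquad \mathcal L_0=\bigoplus_{n\ge0}\mathbf J_{\Gamma_{2n}}:\mathfrak M\oplus\widetilde{\mathfrak H}_0\to\mathfrak N\oplus\mathfrak H_0 .$$ The *block operator CMV matrices* are $\mathcal U_0=\mathcal L_0(I_{\mathfrak M}\oplus\mathcal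 V_0)$ from $\mathfrak M\oplus\mathfrak H_0$ to $\mathfrak N\oplus\mathfrak H_0$ and $\widetilde{\mathcal U}_0=(I_{\mathfrak N}\oplus\mathcal V_0)\mathcal L_0$ from $\mathfrak M\oplus\widetilde{\mathfrak H}_0$ to $\mathfrak N\oplus\widetilde{\mathfrak H}_0$; the *truncated block operator CMV matrices* are $\mathcal T_0(\{\Gamma_n\})=P_{\mathfrak H_0}\mathcal U_0{\upharpoonright}\mathfrak H_0$ and $\widetilde{\mathcal T}_0(\{\Gamma_n\})=P_{\widetilde{\mathfrak H}_0}\widetilde{\mathcal U}_0{\upharpoonright}\widetilde{\mathfrak H}_0$. **Theorem.** Let $T$ be a completely non-unitary contraction in a separable complex Hilbert space $H$ (that is, no nonzero closed subspace reduces $T$ to a unitary operator), and let $$\Phi_T(\lambda)=\bigl(-T+\lambda D_{T^*}(I_H-\lambda T^*)^{-1}D_T\bigr){\upharpoonright}\mathfrak D_T\in\mathbf L(\mathfrak D_T,\mathfrak D_{T^*}),\qquad\lambda\in\mathbb D,$$ be its Sz.-Nagy--Foias characteristic function. If $\{\Gamma_n\}_{n\ge0}$ are the Schur parameters of $\Phi_T$,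 then $T$ is unitarily equivalent to each of the truncated block operator CMV matrices $\mathcal T_0(\{\Gamma_n^*\}_{n\ge0})$ and $\widetilde{\mathcal T}_0(\{\Gamma_n^*\}_{n\ge0})$. -/

import Mathlib

noncomputable section

namespace BlockCMV

/-! ### Contractions, defect operators and defect subspaces -/

section Defect

variable {H₁ H₂ : Type*} [NormedAddCommGroup H₁] [InnerProductSpace ℂ H₁] [CompleteSpace H₁]
  [NormedAddCommGroup H₂] [InnerProductSpace ℂ H₂] [CompleteSpace H₂]

/-- The defect operator `D_T = (I - T^* T)^{1/2}` of a contraction `T`. -/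
def defectOp (T : H₁ →L[ℂ] H₂) : H₁ →L[ℂ] H₁ :=
  CFC.sqrt (1 - (ContinuousLinearMap.adjoint T) ∘L T)

/-- The defect subspace, the closure of the range of `D_T`. -/
def defectSpace (T : H₁ →L[ℂ] H₂) : Submodule ℂ H₁ :=
  (LinearMap.range (defectOp T : H₁ →ₗ[ℂ] H₁)).topologicalClosure

instance (T : H₁ →L[ℂ] H₂) : CompleteSpace (defectSpace T) :=
  (Submodule.isClosed_topologicalClosure _).completeSpace_coe

theorem defectOp_mem (T : H₁ →L[ℂ] H₂) (x : H₁) : defectOp T x ∈ defectSpace T :=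
  Submodule.le_topologicalClosure _ ⟨x, rfl⟩

theorem one_sub_nonneg {T : H₁ →L[ℂ] H₂} (hT : ‖T‖ ≤ 1) :
    0 ≤ 1 - (ContinuousLinearMap.adjoint T) ∘L T := by
  rw [ContinuousLinearMap.nonneg_iff_isPositive, ContinuousLinearMap.isPositive_def']
  refine ⟨?_, fun x => ?_⟩
  · refine (IsSelfAdjoint.one _).sub ?_
    rw [ContinuousLinearMap.isSelfAdjoint_iff', ContinuousLinearMap.adjoint_comp,
      ContinuousLinearMap.adjoint_adjoint]
  · have h1 : ‖T x‖ ≤ ‖x‖ := by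
      simpa using T.le_of_opNorm_le hT x
    simp only [ContinuousLinearMap.reApplyInnerSelf_apply, sub_apply,
      one_apply_eq_self, ContinuousLinearMap.comp_apply, inner_sub_left,
      ContinuousLinearMap.adjoint_inner_left, map_sub, inner_self_eq_norm_sq]
    nlinarith [norm_nonneg (T x)]

theorem defectOp_isSelfAdjoint (T : H₁ →L[ℂ] H₂) :
    ContinuousLinearMap.adjoint (defectOp T) = defectOp T :=
  ContinuousLinearMap.isSelfAdjoint_iff'.1 (IsSelfAdjoint.of_nonneg (CFC.sqrt_nonneg _))

theorem defectOp_norm_sq {T : H₁ →L[ℂ] H₂} (hT : ‖T‖ ≤ 1) (x : H₁) :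
    ‖defectOp T x‖ ^ 2 = ‖x‖ ^ 2 - ‖T x‖ ^ 2 := by
  have h := CFC.sqrt_mul_sqrt_self _ (one_sub_nonneg hT)
  have h2 : defectOp T (defectOp T x) = x - ContinuousLinearMap.adjoint T (T x) := by
    have := congrArg (fun A : H₁ →L[ℂ] H₁ => A x) h
    simpa [defectOp] using this
  have h3 : (inner ℂ (defectOp T x) (defectOp T x) : ℂ)
      = inner ℂ x (x - ContinuousLinearMap.adjoint T (T x)) := by
    rw [← h2, ← ContinuousLinearMap.adjoint_inner_right, defectOp_isSelfAdjoint]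
  rw [inner_sub_right, ContinuousLinearMap.adjoint_inner_right] at h3
  have h4 := congrArg Complex.re h3
  simpa [← inner_self_eq_norm_sq (𝕜 := ℂ)] using h4

theorem norm_defectOp_le {T : H₁ →L[ℂ] H₂} (hT : ‖T‖ ≤ 1) (x : H₁) : ‖defectOp T x‖ ≤ ‖x‖ := by
  have := defectOp_norm_sq hT x
  exact le_of_sq_le_sq (by nlinarith [sq_nonneg ‖T x‖]) (norm_nonneg _)

theorem mem_defectSpace_iff (T : H₁ →L[ℂ] H₂) (y : H₁) :
    y ∈ defectSpace T ↔ ∀ x, defectOp T x = 0 → inner ℂ x y = 0 := by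
  have h : defectSpace T = (LinearMap.ker (defectOp T : H₁ →ₗ[ℂ] H₁))ᗮ := by
    have := ContinuousLinearMap.orthogonal_ker (defectOp T)
    rw [defectOp_isSelfAdjoint] at this
    exact this.symm
  rw [h, Submodule.mem_orthogonal]
  rfl

/-- `T^*` maps the defect subspace of `T^*` into the defect subspace of `T`. -/
theorem adjoint_mem_defectSpace {T : H₁ →L[ℂ] H₂} (hT : ‖T‖ ≤ 1) {y : H₂}
    (hy : y ∈ defectSpace (ContinuousLinearMap.adjoint T)) :
    ContinuousLinearMap.adjoint T y ∈ defectSpace T := by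
  rw [mem_defectSpace_iff] at hy ⊢
  intro x hx
  rw [ContinuousLinearMap.adjoint_inner_right]
  apply hy
  have hT' : ‖ContinuousLinearMap.adjoint T‖ ≤ 1 := by
    simpa using hT
  have h1 := defectOp_norm_sq hT x
  have h := CFC.sqrt_mul_sqrt_self _ (one_sub_nonneg hT)
  have h2 : defectOp T (defectOp T x) = x - ContinuousLinearMap.adjoint T (T x) := by
    have := congrArg (fun A : H₁ →L[ℂ] H₁ => A x) h
    simpa [defectOp] using this
  rw [hx, map_zero] at h2
  have h3 := defectOp_norm_sq hT' (T x)
  rw [← sub_eq_zero.1 h2.symm] at h3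
  rw [hx, norm_zero] at h1
  have h4 : ‖defectOp (ContinuousLinearMap.adjoint T) (T x)‖ ^ 2 = 0 := by
    rw [h3]; nlinarith
  simpa using h4

/-- `T` maps the defect subspace of `T` into the defect subspace of `T^*`. -/
theorem apply_mem_defectSpace {T : H₁ →L[ℂ] H₂} (hT : ‖T‖ ≤ 1) {x : H₁} (hx : x ∈ defectSpace T) :
    T x ∈ defectSpace (ContinuousLinearMap.adjoint T) := by
  have hT' : ‖ContinuousLinearMap.adjoint T‖ ≤ 1 := by
    simpa using hT
  have h := adjoint_mem_defectSpace hT' (y := x)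
  rw [ContinuousLinearMap.adjoint_adjoint] at h
  exact h hx

end Defect

/-! ### Completely non-unitary contractions and the characteristic function -/

section CharFun

variable {H : Type*} [NormedAddCommGroup H] [InnerProductSpace ℂ H] [CompleteSpace H]

/-- A contraction `T` is completely non-unitary if the only closed subspace that reduces `T` and on
which `T` acts as a unitary operator (an isometry onto) is `{0}`. -/
structure IsCompletelyNonUnitary (T : H →L[ℂ] H) : Prop where
  contraction : ‖T‖ ≤ 1
  eq_bot : ∀ K : Submodule ℂ H, IsClosed (K : Set H) →
    Set.MapsTo T K K → Set.MapsTo (ContinuousLinearMap.adjoint T) K K →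
    (∀ x ∈ K, ‖T x‖ = ‖x‖) → Set.SurjOn T K K → K = ⊥

/-- The Sz.-Nagy--Foias characteristic function
`Φ_T(z) = (-T + z D_{T^*} (I - z T^*)⁻¹ D_T) ↾ 𝔇_T`, with values in `L(𝔇_T, 𝔇_{T^*})`. -/
def charFun (T : H →L[ℂ] H) (hT : ‖T‖ ≤ 1) (z : ℂ) :
    defectSpace T →L[ℂ] defectSpace (ContinuousLinearMap.adjoint T) :=
  ((-T + z • (defectOp (ContinuousLinearMap.adjoint T) ∘L
      Ring.inverse (1 - z • ContinuousLinearMap.adjoint T) ∘L defectOp T)) ∘L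
    (defectSpace T).subtypeL).codRestrict _ (fun x =>
      Submodule.add_mem _ (Submodule.neg_mem _ (apply_mem_defectSpace hT x.2))
        (Submodule.smul_mem _ _ (defectOp_mem _ _)))

end CharFun

/-- The Schur class: holomorphic contraction-valued functions on the open unit disk. -/
def IsSchurClass {X Y : Type*} [NormedAddCommGroup X] [InnerProductSpace ℂ X]
    [NormedAddCommGroup Y] [InnerProductSpace ℂ Y] (Θ : ℂ → X →L[ℂ] Y) : Prop :=
  DifferentiableOn ℂ Θ (Metric.ball 0 1) ∧ ∀ z ∈ Metric.ball (0 : ℂ) 1, ‖Θ z‖ ≤ 1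

/-! ### Operators on finite and infinite orthogonal sums -/

section Sums

/-- The operator given by the block matrix `[a b; c d] : X₁ ⊕ X₂ → Y₁ ⊕ Y₂` on Hilbert sums. -/
def blockOp {X₁ X₂ Y₁ Y₂ : Type*}
    [NormedAddCommGroup X₁] [InnerProductSpace ℂ X₁] [NormedAddCommGroup X₂]
    [InnerProductSpace ℂ X₂] [NormedAddCommGroup Y₁] [InnerProductSpace ℂ Y₁]
    [NormedAddCommGroup Y₂] [InnerProductSpace ℂ Y₂]
    (a : X₁ →L[ℂ] Y₁) (b : X₂ →L[ℂ] Y₁) (c : X₁ →L[ℂ] Y₂) (d : X₂ →L[ℂ] Y₂) :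
    WithLp 2 (X₁ × X₂) →L[ℂ] WithLp 2 (Y₁ × Y₂) :=
  ((WithLp.prodContinuousLinearEquiv 2 ℂ Y₁ Y₂).symm : (Y₁ × Y₂) →L[ℂ] WithLp 2 (Y₁ × Y₂)) ∘L
    ((a.coprod b).prod (c.coprod d)) ∘L
    (WithLp.prodContinuousLinearEquiv 2 ℂ X₁ X₂ : WithLp 2 (X₁ × X₂) →L[ℂ] X₁ × X₂)

theorem memℓp_two_iff {X : ℕ → Type*} [∀ n, NormedAddCommGroup (X n)] (f : ∀ n, X n) :
    Memℓp f 2 ↔ Summable fun n => ‖f n‖ ^ 2 := by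
  rw [memℓp_gen_iff (by norm_num)]
  norm_num

theorem hasSum_congr_aux {f g : ℕ → ℝ} {a : ℝ} (h : HasSum f a) (e : ∀ n, g n = f n) :
    HasSum g a := (funext e : g = f) ▸ h

theorem hasSum_norm_sq {X : ℕ → Type*} [∀ n, NormedAddCommGroup (X n)] (f : lp X 2) :
    HasSum (fun n => ‖f n‖ ^ 2) (‖f‖ ^ 2) := by
  have := lp.hasSum_norm (p := 2) (by norm_num) f
  norm_num at this
  exact this

/-- The orthogonal sum `∑ ⊕ A n` of a uniformly bounded sequence of operators. -/
def directSumOp {X Y : ℕ → Type*} [∀ n, NormedAddCommGroup (X n)]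
    [∀ n, InnerProductSpace ℂ (X n)] [∀ n, NormedAddCommGroup (Y n)]
    [∀ n, InnerProductSpace ℂ (Y n)] (A : ∀ n, X n →L[ℂ] Y n) (C : ℝ) (hC : 0 ≤ C)
    (hA : ∀ n x, ‖A n x‖ ≤ C * ‖x‖) : lp X 2 →L[ℂ] lp Y 2 :=
  have hA2 : ∀ (f : lp X 2) (n : ℕ), ‖A n (f n)‖ ^ 2 ≤ C ^ 2 * ‖f n‖ ^ 2 := fun f n => by
    rw [← mul_pow]
    exact pow_le_pow_left₀ (norm_nonneg _) (hA n (f n)) 2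
  let L : lp X 2 →ₗ[ℂ] lp Y 2 :=
    { toFun := fun f => ⟨fun n => A n (f n), (memℓp_two_iff _).2
        (Summable.of_nonneg_of_le (fun n => by positivity) (hA2 f)
          ((hasSum_norm_sq f).summable.mul_left _))⟩
      map_add' := fun f g => by
        ext n
        exact map_add (A n) (f n) (g n)
      map_smul' := fun c f => by
        ext n
        exact map_smul (A n) c (f n) }
  L.mkContinuous C (fun f => by
    have h1 : ‖L f‖ ^ 2 ≤ (C * ‖f‖) ^ 2 := by
      rw [mul_pow]
      exact hasSum_le (hA2 f) (hasSum_norm_sq (L f)) ((hasSum_norm_sq f).mul_left _)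
    exact (sq_le_sq₀ (norm_nonneg _) (by positivity)).1 h1)

theorem directSumOp_apply {X Y : ℕ → Type*} [∀ n, NormedAddCommGroup (X n)]
    [∀ n, InnerProductSpace ℂ (X n)] [∀ n, NormedAddCommGroup (Y n)]
    [∀ n, InnerProductSpace ℂ (Y n)] (A : ∀ n, X n →L[ℂ] Y n) (C : ℝ) (hC : 0 ≤ C)
    (hA : ∀ n x, ‖A n x‖ ≤ C * ‖x‖) (f : lp X 2) (n : ℕ) :
    directSumOp A C hC hA f n = A n (f n) := rfl

/-- The sequence `a₀, a 0, a 1, …`. -/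
def consSeq {A : ℕ → Type*} (a₀ : A 0) (a : ∀ n, A (n + 1)) : ∀ n, A n
  | 0 => a₀
  | n + 1 => a n

theorem summable_norm_sq_fst_snd {X Y : ℕ → Type*} [∀ n, NormedAddCommGroup (X n)]
    [∀ n, NormedAddCommGroup (Y n)] (f : lp (fun n => WithLp 2 (X n × Y n)) 2) :
    (Summable fun n => ‖(f n).fst‖ ^ 2) ∧ Summable fun n => ‖(f n).snd‖ ^ 2 := by
  have h : Summable fun n => ‖(f n).fst‖ ^ 2 + ‖(f n).snd‖ ^ 2 :=
    (hasSum_norm_sq f).summable.congr (fun n => WithLp.prod_norm_sq_eq_of_L2 (f n))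
  exact ⟨Summable.of_nonneg_of_le (fun n => by positivity)
      (fun n => le_add_of_nonneg_right (by positivity)) h,
    Summable.of_nonneg_of_le (fun n => by positivity)
      (fun n => le_add_of_nonneg_left (by positivity)) h⟩

theorem hasSum_consSeq {A : ℕ → Type*} [∀ n, NormedAddCommGroup (A n)] (a₀ : A 0)
    (a : ∀ n, A (n + 1)) (h : Summable fun n => ‖a n‖ ^ 2) :
    HasSum (fun n => ‖consSeq a₀ a n‖ ^ 2) (‖a₀‖ ^ 2 + ∑' n, ‖a n‖ ^ 2) := by
  have h1 := (hasSum_nat_add_iff (f := fun n => ‖consSeq a₀ a n‖ ^ 2)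
    (g := ∑' n, ‖a n‖ ^ 2) 1).1 h.hasSum
  rw [Finset.sum_range_one, add_comm] at h1
  exact h1

section Regroup

variable (A B : ℕ → Type*) [∀ n, NormedAddCommGroup (A n)] [∀ n, InnerProductSpace ℂ (A n)]
  [∀ n, NormedAddCommGroup (B n)] [∀ n, InnerProductSpace ℂ (B n)]

/-- `(a₀, (bₙ, aₙ₊₁)ₙ) ↦ (aₙ, bₙ)ₙ`. -/
def regroupFun (x : WithLp 2 (A 0 × lp (fun n => WithLp 2 (B n × A (n + 1))) 2)) :
    lp (fun n => WithLp 2 (A n × B n)) 2 :=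
  ⟨fun n => WithLp.toLp 2 (consSeq (A := A) x.fst (fun k => (x.snd k).snd) n, (x.snd n).fst),
    (memℓp_two_iff _).2 (((hasSum_consSeq (A := A) x.fst (fun k => (x.snd k).snd)
      (summable_norm_sq_fst_snd x.snd).2).summable.add
      (summable_norm_sq_fst_snd x.snd).1).congr
        (fun n => (WithLp.prod_norm_sq_eq_of_L2 (WithLp.toLp 2
          (consSeq (A := A) x.fst (fun k => (x.snd k).snd) n, (x.snd n).fst))).symm))⟩

/-- `(aₙ, bₙ)ₙ ↦ (a₀, (bₙ, aₙ₊₁)ₙ)`. -/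
def regroupInv (f : lp (fun n => WithLp 2 (A n × B n)) 2) :
    WithLp 2 (A 0 × lp (fun n => WithLp 2 (B n × A (n + 1))) 2) :=
  WithLp.toLp 2 ((f 0).fst, ⟨fun n => WithLp.toLp 2 ((f n).snd, (f (n + 1)).fst),
    (memℓp_two_iff _).2 (((summable_norm_sq_fst_snd f).2.add
      ((summable_nat_add_iff 1).2 (summable_norm_sq_fst_snd f).1)).congr
        (fun n => (WithLp.prod_norm_sq_eq_of_L2 (WithLp.toLp 2
          ((f n).snd, (f (n + 1)).fst))).symm))⟩)

set_option linter.unusedSectionVars false in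
theorem norm_regroupFun (x : WithLp 2 (A 0 × lp (fun n => WithLp 2 (B n × A (n + 1))) 2)) :
    ‖regroupFun A B x‖ = ‖x‖ := by
  obtain ⟨hb, ha⟩ := summable_norm_sq_fst_snd x.snd
  have h1 : HasSum (fun n => ‖(x.snd n).fst‖ ^ 2 + ‖(x.snd n).snd‖ ^ 2) (‖x.snd‖ ^ 2) :=
    hasSum_congr_aux (hasSum_norm_sq x.snd)
      (fun n => (WithLp.prod_norm_sq_eq_of_L2 (x.snd n)).symm)
  have hs := h1.unique (hb.hasSum.add ha.hasSum)
  have h2 := (hasSum_consSeq (A := A) x.fst (fun k => (x.snd k).snd) ha).add hb.hasSum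
  rw [add_assoc, add_comm (∑' n, ‖(x.snd n).snd‖ ^ 2), ← hs] at h2
  rw [← sq_eq_sq₀ (norm_nonneg _) (norm_nonneg _), WithLp.prod_norm_sq_eq_of_L2 x]
  have h3 : HasSum (fun n => ‖regroupFun A B x n‖ ^ 2) (‖x.fst‖ ^ 2 + ‖x.snd‖ ^ 2) :=
    hasSum_congr_aux h2 (fun n => (WithLp.prod_norm_sq_eq_of_L2 (regroupFun A B x n)))
  exact (hasSum_norm_sq (regroupFun A B x)).unique h3

/-- The regrouping `A₀ ⊕ ∑ (Bₙ ⊕ Aₙ₊₁) = ∑ (Aₙ ⊕ Bₙ)` of an orthogonal sum. -/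
def regroup : WithLp 2 (A 0 × lp (fun n => WithLp 2 (B n × A (n + 1))) 2) ≃ₗᵢ[ℂ]
    lp (fun n => WithLp 2 (A n × B n)) 2 where
  toFun := regroupFun A B
  invFun := regroupInv A B
  map_add' x y := by
    refine Subtype.ext (funext fun n => ?_)
    cases n <;> rfl
  map_smul' c x := by
    refine Subtype.ext (funext fun n => ?_)
    cases n <;> rfl
  left_inv x := rfl
  right_inv f := by
    refine Subtype.ext (funext fun n => ?_)
    cases n <;> rfl
  norm_map' := norm_regroupFun A B

end Regroup

end Sums

/-! ### Choice sequences -/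

/-- A choice sequence: contractions `Γ 0 ∈ L(𝔐, 𝔑)` and `Γ (n+1) ∈ L(𝔇_{Γ n}, 𝔇_{Γ n ^*})`. The
defect subspaces are regarded as (closed) subspaces of `𝔐` and `𝔑`: `Γ n` acts from `M n` to `N n`,
where `M 0 = 𝔐`, `N 0 = 𝔑`, `M (n+1) = 𝔇_{Γ n}` and `N (n+1) = 𝔇_{Γ n ^*}`.
A sequence that stops at a unitary `Γ m` is continued by the zero operators on `{0}`. -/
structure ChoiceSequence (𝔐 𝔑 : Type*) [NormedAddCommGroup 𝔐] [InnerProductSpace ℂ 𝔐]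
    [NormedAddCommGroup 𝔑] [InnerProductSpace ℂ 𝔑] where
  M : ℕ → Submodule ℂ 𝔐
  N : ℕ → Submodule ℂ 𝔑
  [completeM : ∀ n, CompleteSpace (M n)]
  [completeN : ∀ n, CompleteSpace (N n)]
  Γ : ∀ n, M n →L[ℂ] N n
  contraction : ∀ n, ‖Γ n‖ ≤ 1
  M_zero : M 0 = ⊤
  N_zero : N 0 = ⊤
  M_succ : ∀ n, M (n + 1) = (defectSpace (Γ n)).map (M n).subtype
  N_succ : ∀ n, N (n + 1) = (defectSpace (ContinuousLinearMap.adjoint (Γ n))).map (N n).subtype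

namespace ChoiceSequence

variable {𝔐 𝔑 : Type*} [NormedAddCommGroup 𝔐] [InnerProductSpace ℂ 𝔐]
  [NormedAddCommGroup 𝔑] [InnerProductSpace ℂ 𝔑]

instance (S : ChoiceSequence 𝔐 𝔑) (n : ℕ) : CompleteSpace (S.M n) := S.completeM n

instance (S : ChoiceSequence 𝔐 𝔑) (n : ℕ) : CompleteSpace (S.N n) := S.completeN n

/-- The choice sequence `{Γ n ^*}`. -/
def adjoint (S : ChoiceSequence 𝔐 𝔑) : ChoiceSequence 𝔑 𝔐 where
  M := S.N
  N := S.M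
  Γ n := ContinuousLinearMap.adjoint (S.Γ n)
  contraction n := by
    rw [LinearIsometryEquiv.norm_map]
    exact S.contraction n
  M_zero := S.N_zero
  N_zero := S.M_zero
  M_succ n := S.N_succ n
  N_succ n := by rw [ContinuousLinearMap.adjoint_adjoint]; exact S.M_succ n

variable (S : ChoiceSequence 𝔐 𝔑)

theorem mem_M_succ (n : ℕ) {x : S.M n} (hx : x ∈ defectSpace (S.Γ n)) :
    (x : 𝔐) ∈ S.M (n + 1) := by
  rw [S.M_succ]; exact ⟨x, hx, rfl⟩

theorem N_succ_le (n : ℕ) : S.N (n + 1) ≤ S.N n := by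
  rw [S.N_succ]; exact Submodule.map_subtype_le _ _

/-- The inclusion of `𝔇_{Γ n ^*}` into `N n`. -/
def inclN (n : ℕ) : S.N (n + 1) →L[ℂ] S.N n :=
  (S.N (n + 1)).subtypeL.codRestrict _ (fun x => S.N_succ_le n x.2)

theorem inclN_mem (n : ℕ) (x : S.N (n + 1)) :
    S.inclN n x ∈ defectSpace (ContinuousLinearMap.adjoint (S.Γ n)) := by
  have h : (x : 𝔑) ∈ (defectSpace (ContinuousLinearMap.adjoint (S.Γ n))).map (S.N n).subtype :=
    S.N_succ n ▸ x.2
  obtain ⟨y, hy, hyx⟩ := h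
  have : S.inclN n x = y := Subtype.ext hyx.symm
  rw [this]
  exact hy

/-- `D_{Γ n} : M n → 𝔇_{Γ n}`. -/
def defect (n : ℕ) : S.M n →L[ℂ] S.M (n + 1) :=
  ((S.M n).subtypeL ∘L defectOp (S.Γ n)).codRestrict _
    (fun x => S.mem_M_succ n (defectOp_mem _ x))

/-- `D_{Γ n ^*} ↾ 𝔇_{Γ n ^*} : 𝔇_{Γ n ^*} → N n`. -/
def defectStar (n : ℕ) : S.N (n + 1) →L[ℂ] S.N n :=
  defectOp (ContinuousLinearMap.adjoint (S.Γ n)) ∘L S.inclN n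

/-- `Γ n ^* ↾ 𝔇_{Γ n ^*} : 𝔇_{Γ n ^*} → 𝔇_{Γ n}`. -/
def adjRestrict (n : ℕ) : S.N (n + 1) →L[ℂ] S.M (n + 1) :=
  ((S.M n).subtypeL ∘L ContinuousLinearMap.adjoint (S.Γ n) ∘L S.inclN n).codRestrict _
    (fun x => S.mem_M_succ n (adjoint_mem_defectSpace (S.contraction n) (S.inclN_mem n x)))

/-- The choice sequence `S` is the sequence of Schur parameters of the function `Φ` on the disk:
there are Schur class functions `Θ n` (the Schur iterates) with `Θ 0 = Φ` on the disk, `Γ n = Θ n 0`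
and `Z (z) = z Θ (n+1) (z)` the Möbius parameter of `Θ n`, that is,
`Θ n z = Γ n + D_{Γ n ^*} Z(z) (I + Γ n ^* Z(z))⁻¹ D_{Γ n}`. -/
def IsSchurParameters (Φ : ℂ → 𝔐 →L[ℂ] 𝔑) : Prop :=
  ∃ Θ : ∀ n, ℂ → (S.M n →L[ℂ] S.N n),
    (∀ n, IsSchurClass (Θ n)) ∧
    (∀ z ∈ Metric.ball (0 : ℂ) 1, ∀ x : S.M 0, (Θ 0 z x : 𝔑) = Φ z (x : 𝔐)) ∧
    (∀ n, S.Γ n = Θ n 0) ∧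
    ∀ n, ∀ z ∈ Metric.ball (0 : ℂ) 1,
      Θ n z = S.Γ n + S.defectStar n ∘L (z • Θ (n + 1) z) ∘L
        Ring.inverse (1 + S.adjRestrict n ∘L (z • Θ (n + 1) z)) ∘L S.defect n

/-! ### Block operator CMV matrices -/

/-- The elementary rotation
`J_{Γ n} = [Γ n, D_{Γ n ^*}; D_{Γ n}, -Γ n ^*] : M n ⊕ 𝔇_{Γ n ^*} → N n ⊕ 𝔇_{Γ n}`.
If `Γ n` is isometric or co-isometric then one of the two defect subspaces is `{0}`, and this is the
row or the column form of the rotation. -/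
def rot (n : ℕ) : WithLp 2 (S.M n × S.N (n + 1)) →L[ℂ] WithLp 2 (S.N n × S.M (n + 1)) :=
  blockOp (S.Γ n) (S.defectStar n) (S.defect n) (-S.adjRestrict n)

theorem rot_bound (n : ℕ) (x : WithLp 2 (S.M n × S.N (n + 1))) :
    ‖S.rot n x‖ ≤ 2 * ‖x‖ := by
  have hc' : ‖ContinuousLinearMap.adjoint (S.Γ n)‖ ≤ 1 := by simpa using S.contraction n
  have h1 : ‖S.Γ n x.fst‖ ≤ ‖x.fst‖ := by
    simpa using (S.Γ n).le_of_opNorm_le (S.contraction n) x.fst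
  have h2 : ‖S.defectStar n x.snd‖ ≤ ‖x.snd‖ := norm_defectOp_le hc' (S.inclN n x.snd)
  have h3 : ‖S.defect n x.fst‖ ≤ ‖x.fst‖ := norm_defectOp_le (S.contraction n) x.fst
  have h4 : ‖S.adjRestrict n x.snd‖ ≤ ‖x.snd‖ := by
    have h := (ContinuousLinearMap.adjoint (S.Γ n)).le_of_opNorm_le hc' (S.inclN n x.snd)
    rw [one_mul] at h
    exact h
  have e : ‖S.rot n x‖ ^ 2 = ‖S.Γ n x.fst + S.defectStar n x.snd‖ ^ 2 +
      ‖S.defect n x.fst + -S.adjRestrict n x.snd‖ ^ 2 := WithLp.prod_norm_sq_eq_of_L2 _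
  have h5 := norm_add_le (S.Γ n x.fst) (S.defectStar n x.snd)
  have h6 := norm_add_le (S.defect n x.fst) (-S.adjRestrict n x.snd)
  rw [norm_neg] at h6
  rw [← sq_le_sq₀ (norm_nonneg _) (by positivity), mul_pow, e, WithLp.prod_norm_sq_eq_of_L2 x]
  have h7 : ‖S.Γ n x.fst + S.defectStar n x.snd‖ ^ 2 ≤ (‖x.fst‖ + ‖x.snd‖) ^ 2 :=
    pow_le_pow_left₀ (norm_nonneg _) (by linarith) 2
  have h8 : ‖S.defect n x.fst + -S.adjRestrict n x.snd‖ ^ 2 ≤ (‖x.fst‖ + ‖x.snd‖) ^ 2 :=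
    pow_le_pow_left₀ (norm_nonneg _) (by linarith) 2
  nlinarith [sq_nonneg (‖x.fst‖ - ‖x.snd‖)]

/-- The state space `ℌ₀ = ∑ₙ ⊕ (𝔇_{Γ 2n} ⊕ 𝔇_{Γ (2n+1) ^*})`. -/
abbrev StateSpace : Type _ :=
  lp (fun n : ℕ => WithLp 2 (S.M (2 * n + 1) × S.N (2 * (n + 1)))) 2

/-- The state space `ℌ̃₀ = ∑ₙ ⊕ (𝔇_{Γ 2n ^*} ⊕ 𝔇_{Γ (2n+1)})`. -/
abbrev StateSpaceTilde : Type _ :=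
  lp (fun n : ℕ => WithLp 2 (S.N (2 * n + 1) × S.M (2 * (n + 1)))) 2

/-- `V₀ = ∑ₙ ⊕ J_{Γ (2n+1)} : ℌ₀ → ℌ̃₀`. -/
def opV : S.StateSpace →L[ℂ] S.StateSpaceTilde :=
  directSumOp (X := fun n : ℕ => WithLp 2 (S.M (2 * n + 1) × S.N (2 * (n + 1))))
    (Y := fun n : ℕ => WithLp 2 (S.N (2 * n + 1) × S.M (2 * (n + 1))))
    (fun n => S.rot (2 * n + 1)) 2 zero_le_two (fun n => S.rot_bound (2 * n + 1))

/-- `ℳ₀ = I_𝔐 ⊕ V₀ : 𝔐 ⊕ ℌ₀ → 𝔐 ⊕ ℌ̃₀`. -/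
def opM : WithLp 2 (S.M 0 × S.StateSpace) →L[ℂ] WithLp 2 (S.M 0 × S.StateSpaceTilde) :=
  blockOp (ContinuousLinearMap.id ℂ _) 0 0 S.opV

/-- `ℳ̃₀ = I_𝔑 ⊕ V₀ : 𝔑 ⊕ ℌ₀ → 𝔑 ⊕ ℌ̃₀`. -/
def opMTilde : WithLp 2 (S.N 0 × S.StateSpace) →L[ℂ] WithLp 2 (S.N 0 × S.StateSpaceTilde) :=
  blockOp (ContinuousLinearMap.id ℂ _) 0 0 S.opV

/-- `ℒ₀ = J_{Γ 0} ⊕ J_{Γ 2} ⊕ J_{Γ 4} ⊕ ⋯ : 𝔐 ⊕ ℌ̃₀ → 𝔑 ⊕ ℌ₀`, where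
`𝔐 ⊕ ℌ̃₀ = (𝔐 ⊕ 𝔇_{Γ 0 ^*}) ⊕ (𝔇_{Γ 1} ⊕ 𝔇_{Γ 2 ^*}) ⊕ ⋯` and
`𝔑 ⊕ ℌ₀ = (𝔑 ⊕ 𝔇_{Γ 0}) ⊕ (𝔇_{Γ 1 ^*} ⊕ 𝔇_{Γ 2}) ⊕ ⋯`. -/
def opL : WithLp 2 (S.M 0 × S.StateSpaceTilde) →L[ℂ] WithLp 2 (S.N 0 × S.StateSpace) :=
  ((regroup (fun n => S.N (2 * n)) (fun n => S.M (2 * n + 1))).symm :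
      lp (fun n : ℕ => WithLp 2 (S.N (2 * n) × S.M (2 * n + 1))) 2 →L[ℂ]
        WithLp 2 (S.N 0 × S.StateSpace)) ∘L
    directSumOp (X := fun n : ℕ => WithLp 2 (S.M (2 * n) × S.N (2 * n + 1)))
      (Y := fun n : ℕ => WithLp 2 (S.N (2 * n) × S.M (2 * n + 1)))
      (fun n => S.rot (2 * n)) 2 zero_le_two (fun n => S.rot_bound (2 * n)) ∘L
    (regroup (fun n => S.M (2 * n)) (fun n => S.N (2 * n + 1)) :
      WithLp 2 (S.M 0 × S.StateSpaceTilde) →L[ℂ]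
        lp (fun n : ℕ => WithLp 2 (S.M (2 * n) × S.N (2 * n + 1))) 2)

/-- The block operator CMV matrix `𝒰₀ = ℒ₀ ℳ₀ : 𝔐 ⊕ ℌ₀ → 𝔑 ⊕ ℌ₀`. -/
def cmv : WithLp 2 (S.M 0 × S.StateSpace) →L[ℂ] WithLp 2 (S.N 0 × S.StateSpace) :=
  S.opL ∘L S.opM

/-- The block operator CMV matrix `𝒰̃₀ = ℳ̃₀ ℒ₀ : 𝔐 ⊕ ℌ̃₀ → 𝔑 ⊕ ℌ̃₀`. -/
def cmvTilde :
    WithLp 2 (S.M 0 × S.StateSpaceTilde) →L[ℂ] WithLp 2 (S.N 0 × S.StateSpaceTilde) :=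
  S.opMTilde ∘L S.opL

end ChoiceSequence

/-- The compression `P_H U ↾ H` of an operator `U : X ⊕ H → Y ⊕ H` to `H`. -/
def truncation {X Y H : Type*} [NormedAddCommGroup X] [InnerProductSpace ℂ X]
    [NormedAddCommGroup Y] [InnerProductSpace ℂ Y] [NormedAddCommGroup H] [InnerProductSpace ℂ H]
    (U : WithLp 2 (X × H) →L[ℂ] WithLp 2 (Y × H)) : H →L[ℂ] H :=
  ContinuousLinearMap.snd ℂ Y H ∘L
    (WithLp.prodContinuousLinearEquiv 2 ℂ Y H : WithLp 2 (Y × H) →L[ℂ] Y × H) ∘L U ∘L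
    ((WithLp.prodContinuousLinearEquiv 2 ℂ X H).symm : (X × H) →L[ℂ] WithLp 2 (X × H)) ∘L
    ContinuousLinearMap.inr ℂ X H

namespace ChoiceSequence

variable {𝔐 𝔑 : Type*} [NormedAddCommGroup 𝔐] [InnerProductSpace ℂ 𝔐]
  [NormedAddCommGroup 𝔑] [InnerProductSpace ℂ 𝔑] (S : ChoiceSequence 𝔐 𝔑)

/-- The truncated block operator CMV matrix `𝒯₀ = P_{ℌ₀} 𝒰₀ ↾ ℌ₀`. -/
def truncatedCMV : S.StateSpace →L[ℂ] S.StateSpace :=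
  truncation S.cmv

/-- The truncated block operator CMV matrix `𝒯̃₀ = P_{ℌ̃₀} 𝒰̃₀ ↾ ℌ̃₀`. -/
def truncatedCMVTilde : S.StateSpaceTilde →L[ℂ] S.StateSpaceTilde :=
  truncation S.cmvTilde

end ChoiceSequence

/-- Operators `A` on `X` and `B` on `Y` are unitarily equivalent. -/
def UnitarilyEquivalent {X Y : Type*} [NormedAddCommGroup X] [InnerProductSpace ℂ X]
    [NormedAddCommGroup Y] [InnerProductSpace ℂ Y] (A : X →L[ℂ] X) (B : Y →L[ℂ] Y) : Prop :=
  ∃ W : X ≃ₗᵢ[ℂ] Y, ∀ x, W (A x) = B (W x)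

end BlockCMV

end

noncomputable section

namespace BlockCMV

/-! A unitary operator `U = [D C; B A] : X ⊕ H → Y ⊕ H` (a unitary colligation) has a transfer
function `D + zC(I - zA)⁻¹B` with Taylor coefficients `D`, `C Aᵏ B`. If `U` is simple, that is, if
the vectors `Aᵏ B x` and `A*ᵏ C* y` span a dense subspace of `H`, then these coefficients determine
`A` up to unitary equivalence: the relations `U* U = I` and `U U* = I` express every inner product
of two such vectors through the coefficients, and two total families with the same Gram matrix are
carried into each other by a unitary operator (`SameMarkov.unitarilyEquivalent`).

Two simple colligations share the transfer function `Φ_T`. One is `[-T, D_{T*}; D_T, T*]`, with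
state operator `T*`; its simplicity follows from complete non-unitarity
(`isSimple_charColligation`). The other is the CMV matrix `𝒰₀` of `{Γ n}`; it is simple because the
rotations leave no room for a decoupled reducing subspace (`isSimple_unitaryCMV`), and it realizes
`Φ_T` because one step of the Schur algorithm is one application of a rotation `J_{Γ n}`
(`IsSchurParameters.exists_state`).

Hence `T*` is unitarily equivalent to `𝒯₀({Γ n})`. Passing to inverse colligations replaces `T*` by
`T` and `𝒰₀({Γ n})` by `𝒰̃₀({Γ n*})`, which settles the matrix with the tilde; the operator `V₀` of
the adjoint sequence intertwines the two truncated matrices. -/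

theorem denseRange_linearCombination {ι E : Type*} [NormedAddCommGroup E] [InnerProductSpace ℂ E]
    (v : ι → E) (hv : (Submodule.span ℂ (Set.range v)).topologicalClosure = ⊤) :
    DenseRange (Finsupp.linearCombination ℂ v) := by
  rw [DenseRange, ← LinearMap.coe_range, Finsupp.range_linearCombination]
  exact Submodule.dense_iff_topologicalClosure_eq_top.2 hv

/-- Two total families of vectors with the same Gram matrix are related by a unitary operator. -/
theorem exists_linearIsometryEquiv_of_inner_eq {ι E F : Type*} [NormedAddCommGroup E]
    [InnerProductSpace ℂ E] [CompleteSpace E] [NormedAddCommGroup F] [InnerProductSpace ℂ F]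
    [CompleteSpace F] (v : ι → E) (w : ι → F)
    (h : ∀ i j, inner ℂ (v i) (v j) = inner ℂ (w i) (w j))
    (hv : (Submodule.span ℂ (Set.range v)).topologicalClosure = ⊤)
    (hw : (Submodule.span ℂ (Set.range w)).topologicalClosure = ⊤) :
    ∃ W : E ≃ₗᵢ[ℂ] F, ∀ i, W (v i) = w i := by
  have hnorm : ∀ x : ι →₀ ℂ, ‖Finsupp.linearCombination ℂ w (LinearEquiv.refl ℂ (ι →₀ ℂ) x)‖ =
      ‖Finsupp.linearCombination ℂ v x‖ := by
    intro x
    have key : (inner ℂ (Finsupp.linearCombination ℂ w x) (Finsupp.linearCombination ℂ w x) : ℂ) =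
        inner ℂ (Finsupp.linearCombination ℂ v x) (Finsupp.linearCombination ℂ v x) := by
      simp only [Finsupp.linearCombination_apply, Finsupp.sum, sum_inner, inner_sum,
        inner_smul_left, inner_smul_right, h]
    rw [inner_self_eq_norm_sq_to_K, inner_self_eq_norm_sq_to_K] at key
    have key2 : ‖Finsupp.linearCombination ℂ w x‖ ^ 2 = ‖Finsupp.linearCombination ℂ v x‖ ^ 2 := by
      exact_mod_cast key
    exact (sq_eq_sq₀ (norm_nonneg _) (norm_nonneg _)).1 key2
  refine ⟨(LinearEquiv.refl ℂ (ι →₀ ℂ)).extendOfIsometry (Finsupp.linearCombination ℂ v)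
    (Finsupp.linearCombination ℂ w) (denseRange_linearCombination v hv) (denseRange_linearCombination w hw) hnorm, fun i => ?_⟩
  have h1 := LinearEquiv.extendOfIsometry_eq (LinearEquiv.refl ℂ (ι →₀ ℂ))
    (Finsupp.linearCombination ℂ v) (Finsupp.linearCombination ℂ w) (denseRange_linearCombination v hv) (denseRange_linearCombination w hw)
    hnorm (Finsupp.single i 1)
  simpa using h1

/-! ### Unitary colligations -/

section Colligation

variable {X Y H K : Type*} [NormedAddCommGroup X] [InnerProductSpace ℂ X]
  [NormedAddCommGroup Y] [InnerProductSpace ℂ Y] [NormedAddCommGroup H] [InnerProductSpace ℂ H]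
  [NormedAddCommGroup K] [InnerProductSpace ℂ K]

theorem inner_toLp_prod (x : X) (h : H) (x' : X) (h' : H) :
    inner ℂ (WithLp.toLp 2 (x, h)) (WithLp.toLp 2 (x', h')) = inner ℂ x x' + inner ℂ h h' :=
  WithLp.prod_inner_apply _ _

/-- The feedthrough operator `X → Y` of a colligation `X ⊕ H → Y ⊕ H`. -/
def feedthrough (U : WithLp 2 (X × H) ≃ₗᵢ[ℂ] WithLp 2 (Y × H)) (x : X) : Y :=
  (U (WithLp.toLp 2 (x, 0))).fst

/-- The input operator `X → H` of a colligation `X ⊕ H → Y ⊕ H`. -/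
def inputOp (U : WithLp 2 (X × H) ≃ₗᵢ[ℂ] WithLp 2 (Y × H)) (x : X) : H :=
  (U (WithLp.toLp 2 (x, 0))).snd

/-- The output operator `H → Y` of a colligation `X ⊕ H → Y ⊕ H`. -/
def outputOp (U : WithLp 2 (X × H) ≃ₗᵢ[ℂ] WithLp 2 (Y × H)) : H →L[ℂ] Y :=
  ContinuousLinearMap.fst ℂ Y H ∘L
    (WithLp.prodContinuousLinearEquiv 2 ℂ Y H : WithLp 2 (Y × H) →L[ℂ] Y × H) ∘L
    (U : WithLp 2 (X × H) →L[ℂ] WithLp 2 (Y × H)) ∘L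
    ((WithLp.prodContinuousLinearEquiv 2 ℂ X H).symm : (X × H) →L[ℂ] WithLp 2 (X × H)) ∘L
    ContinuousLinearMap.inr ℂ X H

/-- The state operator `H → H` of a colligation `X ⊕ H → Y ⊕ H`. -/
def stateOp (U : WithLp 2 (X × H) ≃ₗᵢ[ℂ] WithLp 2 (Y × H)) : H →L[ℂ] H :=
  truncation (U : WithLp 2 (X × H) →L[ℂ] WithLp 2 (Y × H))

variable (U : WithLp 2 (X × H) ≃ₗᵢ[ℂ] WithLp 2 (Y × H))
  (V : WithLp 2 (X × K) ≃ₗᵢ[ℂ] WithLp 2 (Y × K))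

theorem colligation_input (x : X) :
    U (WithLp.toLp 2 (x, 0)) = WithLp.toLp 2 (feedthrough U x, inputOp U x) := rfl

theorem colligation_state (h : H) :
    U (WithLp.toLp 2 (0, h)) = WithLp.toLp 2 (outputOp U h, stateOp U h) := rfl

theorem colligation_apply (x : X) (h : H) :
    U (WithLp.toLp 2 (x, h)) =
      WithLp.toLp 2 (feedthrough U x + outputOp U h, inputOp U x + stateOp U h) := by
  have : WithLp.toLp 2 (x, h) = WithLp.toLp 2 (x, (0 : H)) + WithLp.toLp 2 ((0 : X), h) := by
    rw [← WithLp.toLp_add]; simp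
  rw [this, map_add, colligation_input, colligation_state]
  rfl

/-- Unitarity makes `U.symm` the adjoint of `U`. Its blocks thus serve as `D*`, `B*`, `C*`, `A*`,
and no completeness of the spaces is needed to speak of adjoints. -/
theorem inner_colligation (p : WithLp 2 (X × H)) (q : WithLp 2 (Y × H)) :
    inner ℂ (U p) q = inner ℂ p (U.symm q) := by
  rw [← U.inner_map_map p, U.apply_symm_apply]

theorem inner_stateOp_left (h h' : H) :
    inner ℂ (stateOp U h) h' = inner ℂ h (stateOp U.symm h') := by
  have := inner_colligation U (WithLp.toLp 2 (0, h)) (WithLp.toLp 2 (0, h'))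
  rw [colligation_state, colligation_state, inner_toLp_prod, inner_toLp_prod] at this
  simpa using this

theorem inner_outputOp_left (h : H) (y : Y) :
    inner ℂ (outputOp U h) y = inner ℂ h (inputOp U.symm y) := by
  have := inner_colligation U (WithLp.toLp 2 (0, h)) (WithLp.toLp 2 (y, 0))
  rw [colligation_state, colligation_input, inner_toLp_prod, inner_toLp_prod] at this
  simpa using this

theorem inner_inputOp_left (x : X) (h : H) :
    inner ℂ (inputOp U x) h = inner ℂ x (outputOp U.symm h) := by
  have := inner_colligation U (WithLp.toLp 2 (x, 0)) (WithLp.toLp 2 (0, h))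
  rw [colligation_state, colligation_input, inner_toLp_prod, inner_toLp_prod] at this
  simpa using this

theorem inner_feedthrough_left (x : X) (y : Y) :
    inner ℂ (feedthrough U x) y = inner ℂ x (feedthrough U.symm y) := by
  have := inner_colligation U (WithLp.toLp 2 (x, 0)) (WithLp.toLp 2 (y, 0))
  rw [colligation_input, colligation_input, inner_toLp_prod, inner_toLp_prod] at this
  simpa using this

theorem inner_stateOp_pow_left (k : ℕ) (h h' : H) :
    inner ℂ ((stateOp U ^ k) h) h' = inner ℂ h ((stateOp U.symm ^ k) h') := by
  induction k generalizing h h' with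
  | zero => simp
  | succ k ih =>
    rw [pow_succ, pow_succ', mul_apply_eq_comp, ih, inner_stateOp_left]
    rfl

/-- `A* A = I - C* C`. -/
theorem stateOp_symm_stateOp (h : H) :
    stateOp U.symm (stateOp U h) = h - inputOp U.symm (outputOp U h) := by
  have h1 := U.symm_apply_apply (WithLp.toLp 2 (0, h))
  rw [colligation_state, colligation_apply] at h1
  have h2 : inputOp U.symm (outputOp U h) + stateOp U.symm (stateOp U h) = h :=
    congrArg WithLp.snd h1
  rw [eq_sub_iff_add_eq', h2]

/-- The state component of `U* U = I` on `X ⊕ 0` reads `A* B = -C* D`. -/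
theorem stateOp_symm_inputOp (x : X) :
    stateOp U.symm (inputOp U x) = -inputOp U.symm (feedthrough U x) := by
  have h1 := U.symm_apply_apply (WithLp.toLp 2 (x, 0))
  rw [colligation_input, colligation_apply] at h1
  have h2 : inputOp U.symm (feedthrough U x) + stateOp U.symm (inputOp U x) = 0 :=
    congrArg WithLp.snd h1
  exact eq_neg_of_add_eq_zero_right h2

theorem stateOp_stateOp_symm (h : H) :
    stateOp U (stateOp U.symm h) = h - inputOp U (outputOp U.symm h) := by
  simpa using stateOp_symm_stateOp U.symm h

theorem stateOp_inputOp_symm (y : Y) :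
    stateOp U (inputOp U.symm y) = -inputOp U (feedthrough U.symm y) := by
  simpa using stateOp_symm_inputOp U.symm y

/-! ### Simple colligations -/

/-- The vectors `Aᵏ B x` and `A*ᵏ C* y`. -/
def generators : (ℕ × X) ⊕ (ℕ × Y) → H :=
  Sum.elim (fun p => (stateOp U ^ p.1) (inputOp U p.2))
    (fun p => (stateOp U.symm ^ p.1) (inputOp U.symm p.2))

/-- A colligation is simple if the controllable and the observable subspaces span the state space. -/
def IsSimple : Prop :=
  (Submodule.span ℂ (Set.range (generators U))).topologicalClosure = ⊤

theorem generators_symm_swap (i : (ℕ × X) ⊕ (ℕ × Y)) :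
    generators U.symm i.swap = generators U i := by
  rcases i with i | i <;> simp [generators]

/-- On `A*ᵏ C* y` the operator `A*` only raises the exponent. On `Aᵏ B x` it lowers the exponent up
to a vector `C* y`, by `A* A = I - C* C`, or ends in `-C* D x` by `A* B = -C* D`. -/
theorem stateOp_symm_mem_span (i : (ℕ × X) ⊕ (ℕ × Y)) :
    stateOp U.symm (generators U i) ∈ Submodule.span ℂ (Set.range (generators U)) := by
  have hl : ∀ k x, (stateOp U ^ k) (inputOp U x) ∈ Submodule.span ℂ (Set.range (generators U)) :=
    fun k x => Submodule.subset_span ⟨Sum.inl (k, x), rfl⟩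
  have hr : ∀ k y, (stateOp U.symm ^ k) (inputOp U.symm y) ∈
      Submodule.span ℂ (Set.range (generators U)) :=
    fun k y => Submodule.subset_span ⟨Sum.inr (k, y), rfl⟩
  rcases i with ⟨k, x⟩ | ⟨k, y⟩
  · rcases k with _ | k
    · change stateOp U.symm (inputOp U x) ∈ _
      rw [stateOp_symm_inputOp]
      exact Submodule.neg_mem _ (hr 0 _)
    · change stateOp U.symm ((stateOp U ^ (k + 1)) (inputOp U x)) ∈ _
      rw [pow_succ', mul_apply_eq_comp, stateOp_symm_stateOp]
      exact Submodule.sub_mem _ (hl k x) (hr 0 _)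
  · change stateOp U.symm ((stateOp U.symm ^ k) (inputOp U.symm y)) ∈ _
    rw [← mul_apply_eq_comp, ← pow_succ']
    exact hr _ _

theorem stateOp_mem_orthogonal {h : H}
    (hh : h ∈ (Submodule.span ℂ (Set.range (generators U)))ᗮ) :
    stateOp U h ∈ (Submodule.span ℂ (Set.range (generators U)))ᗮ := by
  rw [Submodule.mem_orthogonal] at hh ⊢
  intro u hu
  have hle : Submodule.span ℂ (Set.range (generators U)) ≤
      (Submodule.span ℂ (Set.range (generators U))).comap (stateOp U.symm : H →ₗ[ℂ] H) := by
    rw [Submodule.span_le]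
    rintro _ ⟨i, rfl⟩
    exact stateOp_symm_mem_span U i
  have h1 := hh _ (hle hu)
  rw [← inner_conj_symm, inner_stateOp_left, inner_conj_symm]
  exact h1

/-- The vector `C* C h` is itself a generator, so `‖C h‖² = ⟨h, C* C h⟩ = 0`. -/
theorem outputOp_eq_zero_of_mem_orthogonal {h : H}
    (hh : h ∈ (Submodule.span ℂ (Set.range (generators U)))ᗮ) : outputOp U h = 0 := by
  rw [← inner_self_eq_zero (𝕜 := ℂ), inner_outputOp_left]
  exact (Submodule.mem_orthogonal' _ _).1 hh _
    (Submodule.subset_span ⟨Sum.inr (0, outputOp U h), rfl⟩)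

/-- Inversion exchanges the two halves of the family. Facts about `A` and `C` on the orthogonal
complement thereby yield those about `A*` and `B*`. -/
theorem span_generators_symm : Submodule.span ℂ (Set.range (generators U.symm)) =
    Submodule.span ℂ (Set.range (generators U)) := by
  congr 1
  ext z
  constructor
  · rintro ⟨i, rfl⟩
    exact ⟨i.swap, by rw [← generators_symm_swap, Sum.swap_swap]⟩
  · rintro ⟨i, rfl⟩
    exact ⟨i.swap, generators_symm_swap U i⟩

/-- A colligation is simple if its state operator has no unitary part
that is decoupled from the outer spaces. -/
theorem isSimple_of_forall_reducing [CompleteSpace H]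
    (hU : ∀ L : Submodule ℂ H, IsClosed (L : Set H) → (∀ h ∈ L, stateOp U h ∈ L) →
      (∀ h ∈ L, stateOp U.symm h ∈ L) → (∀ h ∈ L, outputOp U h = 0) →
      (∀ h ∈ L, outputOp U.symm h = 0) → L = ⊥) : IsSimple U := by
  rw [IsSimple, Submodule.topologicalClosure_eq_top_iff]
  -- The orthogonal complement of the generators is itself a decoupled reducing subspace.
  refine hU _ (Submodule.isClosed_orthogonal _) (fun h hh => stateOp_mem_orthogonal U hh)
    (fun h hh => ?_) (fun h hh => outputOp_eq_zero_of_mem_orthogonal U hh) (fun h hh => ?_)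
  · rw [← span_generators_symm] at hh ⊢
    exact stateOp_mem_orthogonal U.symm hh
  · rw [← span_generators_symm] at hh
    exact outputOp_eq_zero_of_mem_orthogonal U.symm hh

/-! ### Markov parameters determine a simple colligation -/

/-- Two colligations have the same Markov parameters `D`, `C Aᵏ B`. -/
structure SameMarkov : Prop where
  feedthrough_eq : ∀ x, feedthrough U x = feedthrough V x
  moment_eq : ∀ k x, outputOp U ((stateOp U ^ k) (inputOp U x)) =
    outputOp V ((stateOp V ^ k) (inputOp V x))

variable {U V}

/-- The Markov parameters of the inverse are the adjoints `D*` and `B* A*ᵏ C*` of the original ones.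
-/
theorem SameMarkov.symm (h : SameMarkov U V) : SameMarkov U.symm V.symm where
  feedthrough_eq y := by
    refine ext_inner_left ℂ fun x => ?_
    rw [← inner_feedthrough_left, ← inner_feedthrough_left, h.feedthrough_eq]
  moment_eq k y := by
    refine ext_inner_left ℂ fun x => ?_
    rw [← inner_inputOp_left, ← inner_inputOp_left, ← inner_stateOp_pow_left,
      ← inner_stateOp_pow_left, ← inner_outputOp_left, ← inner_outputOp_left, h.moment_eq]

theorem inner_stateOp_stateOp (h h' : H) :
    inner ℂ (stateOp U h) (stateOp U h') = inner ℂ h h' - inner ℂ (outputOp U h) (outputOp U h') := by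
  rw [inner_stateOp_left, stateOp_symm_stateOp, inner_sub_right, inner_outputOp_left]

theorem inner_inputOp_stateOp (x : X) (h : H) :
    inner ℂ (inputOp U x) (stateOp U h) = -inner ℂ (feedthrough U x) (outputOp U h) := by
  have := U.inner_map_map (WithLp.toLp 2 (x, 0)) (WithLp.toLp 2 (0, h))
  rw [colligation_state, colligation_input, inner_toLp_prod, inner_toLp_prod, inner_zero_left,
    inner_zero_right, zero_add] at this
  exact eq_neg_of_add_eq_zero_right this

theorem inner_inputOp_inputOp (x x' : X) :
    inner ℂ (inputOp U x) (inputOp U x') =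
      inner ℂ x x' - inner ℂ (feedthrough U x) (feedthrough U x') := by
  have := U.inner_map_map (WithLp.toLp 2 (x, 0)) (WithLp.toLp 2 (x', 0))
  rw [colligation_input, colligation_input, inner_toLp_prod, inner_toLp_prod, inner_zero_left,
    add_zero] at this
  rw [← this, add_sub_cancel_left]

/-- The identity `A* A = I - C* C` strips one `A` from both sides at the cost of a product of Markov
parameters. Once one exponent is zero, `B* A = -D* C` and `B* B = I - D* D` leave nothing but Markov
parameters. -/
theorem SameMarkov.inner_controllable (h : SameMarkov U V) (k l : ℕ) (x x' : X) :
    inner ℂ ((stateOp U ^ k) (inputOp U x)) ((stateOp U ^ l) (inputOp U x')) =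
      inner ℂ ((stateOp V ^ k) (inputOp V x)) ((stateOp V ^ l) (inputOp V x')) := by
  have h0 : ∀ l (x x' : X), inner ℂ (inputOp U x) ((stateOp U ^ l) (inputOp U x')) =
      inner ℂ (inputOp V x) ((stateOp V ^ l) (inputOp V x')) := by
    intro l x x'
    rcases l with _ | l
    · simp only [pow_zero, one_apply_eq_self, inner_inputOp_inputOp, h.feedthrough_eq]
    · rw [pow_succ', mul_apply_eq_comp, inner_inputOp_stateOp, h.feedthrough_eq,
        h.moment_eq, pow_succ', mul_apply_eq_comp, inner_inputOp_stateOp]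
  induction k generalizing l with
  | zero => simpa using h0 l x x'
  | succ k ih =>
    rcases l with _ | l
    · rw [← inner_conj_symm, ← inner_conj_symm (((stateOp V) ^ (k + 1)) _)]
      simpa using congrArg (starRingEnd ℂ) (h0 (k + 1) x' x)
    · simp only [pow_succ' _ k, pow_succ' _ l, mul_apply_eq_comp,
        inner_stateOp_stateOp, ih, h.moment_eq]

/-- Moving `A*ˡ C*` across the inner product leaves `⟨C Aˡ⁺ᵏ B x, y⟩`. -/
theorem SameMarkov.inner_controllable_observable (h : SameMarkov U V) (k l : ℕ) (x : X) (y : Y) :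
    inner ℂ ((stateOp U ^ k) (inputOp U x)) ((stateOp U.symm ^ l) (inputOp U.symm y)) =
      inner ℂ ((stateOp V ^ k) (inputOp V x)) ((stateOp V.symm ^ l) (inputOp V.symm y)) := by
  rw [← inner_stateOp_pow_left, ← inner_stateOp_pow_left, ← inner_outputOp_left,
    ← inner_outputOp_left, ← mul_apply_eq_comp, ← mul_apply_eq_comp,
    ← pow_add, ← pow_add, h.moment_eq]

theorem SameMarkov.inner_generators (h : SameMarkov U V) (i j : (ℕ × X) ⊕ (ℕ × Y)) :
    inner ℂ (generators U i) (generators U j) = inner ℂ (generators V i) (generators V j) := by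
  rcases i with ⟨k, x⟩ | ⟨k, y⟩ <;> rcases j with ⟨l, x'⟩ | ⟨l, y'⟩
  · exact h.inner_controllable k l x x'
  · exact h.inner_controllable_observable k l x y'
  · rw [← inner_conj_symm, ← inner_conj_symm (generators V _)]
    exact congrArg _ (h.inner_controllable_observable l k x' y)
  · exact h.symm.inner_controllable k l y y'

/-- Simple unitary colligations with the same Markov parameters are unitarily equivalent. -/
theorem SameMarkov.unitarilyEquivalent [CompleteSpace H] [CompleteSpace K] (h : SameMarkov U V)
    (hU : IsSimple U) (hV : IsSimple V) : UnitarilyEquivalent (stateOp U) (stateOp V) := by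
  obtain ⟨W, hW⟩ := exists_linearIsometryEquiv_of_inner_eq _ _ h.inner_generators hU hV
  refine ⟨W, fun z => ?_⟩
  have hl : ∀ k x, W ((stateOp U ^ k) (inputOp U x)) = (stateOp V ^ k) (inputOp V x) :=
    fun k x => hW (Sum.inl (k, x))
  have hr : ∀ k y, W ((stateOp U.symm ^ k) (inputOp U.symm y)) =
      (stateOp V.symm ^ k) (inputOp V.symm y) := fun k y => hW (Sum.inr (k, y))
  have key : (W : H →L[ℂ] K) ∘L stateOp U = stateOp V ∘L (W : H →L[ℂ] K) := by
    refine ContinuousLinearMap.ext_on (s := Set.range (generators U))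
      (Submodule.dense_iff_topologicalClosure_eq_top.2 hU) ?_
    rintro _ ⟨i, rfl⟩
    change W (stateOp U (generators U i)) = stateOp V (W (generators U i))
    rw [hW]
    -- `A` sends generators into the span by formulas involving only Markov parameters: it shifts
    -- `Aᵏ B x`, maps `C* y` to `-B D* y`, and lowers the exponent in `A*ᵏ⁺¹ C* y` because `A A* = I
    -- - B B*`.
    rcases i with ⟨k, x⟩ | ⟨k, y⟩
    · have := hl (k + 1) x
      rw [pow_succ', pow_succ'] at this
      exact this
    · rcases k with _ | k
      · change W (stateOp U (inputOp U.symm y)) = stateOp V (inputOp V.symm y)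
        rw [stateOp_inputOp_symm, stateOp_inputOp_symm, map_neg]
        have := hl 0 (feedthrough U.symm y)
        rw [h.symm.feedthrough_eq] at this ⊢
        exact congrArg Neg.neg this
      · change W (stateOp U ((stateOp U.symm ^ (k + 1)) (inputOp U.symm y))) =
          stateOp V ((stateOp V.symm ^ (k + 1)) (inputOp V.symm y))
        rw [pow_succ', pow_succ', mul_apply_eq_comp, mul_apply_eq_comp,
          stateOp_stateOp_symm, stateOp_stateOp_symm, map_sub, hr, h.symm.moment_eq]
        exact congrArg _ (hl 0 _)
  exact congrArg (fun A : H →L[ℂ] K => A z) key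

/-! ### Transfer functions determine Markov parameters -/

theorem norm_sq_outputOp_add_stateOp (h : H) :
    ‖outputOp U h‖ ^ 2 + ‖stateOp U h‖ ^ 2 = ‖h‖ ^ 2 := by
  have h1 := U.norm_map (WithLp.toLp 2 (0, h))
  rw [colligation_state, ← sq_eq_sq₀ (norm_nonneg _) (norm_nonneg _), WithLp.prod_norm_sq_eq_of_L2,
    WithLp.prod_norm_sq_eq_of_L2] at h1
  simpa using h1

theorem norm_outputOp_le (h : H) : ‖outputOp U h‖ ≤ ‖h‖ :=
  le_of_sq_le_sq (by nlinarith [norm_sq_outputOp_add_stateOp (U := U) h, sq_nonneg ‖stateOp U h‖])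
    (norm_nonneg _)

theorem norm_stateOp_le (h : H) : ‖stateOp U h‖ ≤ ‖h‖ :=
  le_of_sq_le_sq (by nlinarith [norm_sq_outputOp_add_stateOp (U := U) h, sq_nonneg ‖outputOp U h‖])
    (norm_nonneg _)

theorem norm_stateOp_pow_le (n : ℕ) (h : H) : ‖(stateOp U ^ n) h‖ ≤ ‖h‖ := by
  induction n with
  | zero => simp
  | succ n ih =>
    rw [pow_succ', mul_apply_eq_comp]
    exact (norm_stateOp_le _).trans ih

theorem transfer_eqs {x : X} {y : Y} {h : H} {z : ℂ}
    (e : U (WithLp.toLp 2 (x, z • h)) = WithLp.toLp 2 (y, h)) :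
    y = feedthrough U x + z • outputOp U h ∧ h = inputOp U x + z • stateOp U h := by
  rw [colligation_apply, map_smul, map_smul] at e
  exact ⟨(congrArg WithLp.fst e).symm, (congrArg WithLp.snd e).symm⟩

/-- Unitarity gives `‖y‖² + ‖h‖² = ‖x‖² + |z|²‖h‖²`, hence `(3/4)‖h‖² ≤ ‖x‖²`. What matters is that
the bound is uniform in `z`. -/
theorem transfer_norm_le {x : X} {y : Y} {h : H} {z : ℂ} (hz : ‖z‖ ≤ 1 / 2)
    (e : U (WithLp.toLp 2 (x, z • h)) = WithLp.toLp 2 (y, h)) : ‖h‖ ≤ 2 * ‖x‖ := by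
  have h1 := U.norm_map (WithLp.toLp 2 (x, z • h))
  rw [e, ← sq_eq_sq₀ (norm_nonneg _) (norm_nonneg _), WithLp.prod_norm_sq_eq_of_L2,
    WithLp.prod_norm_sq_eq_of_L2] at h1
  change ‖y‖ ^ 2 + ‖h‖ ^ 2 = ‖x‖ ^ 2 + ‖z • h‖ ^ 2 at h1
  have h2 : ‖z • h‖ ≤ 1 / 2 * ‖h‖ := by
    rw [norm_smul]
    gcongr
  have h3 : ‖z • h‖ ^ 2 ≤ (1 / 2 * ‖h‖) ^ 2 := by gcongr
  refine le_of_sq_le_sq ?_ (by positivity)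
  nlinarith [sq_nonneg ‖y‖, sq_nonneg ‖x‖]

/-- Two unitary colligations whose transfer functions agree near the origin have the same
Markov parameters; agreement is expressed by common outputs `y` of both colligations. -/
theorem sameMarkov_of_transfer {r : ℝ} (hr : 0 < r)
    (h : ∀ z : ℂ, ‖z‖ < r → ∀ x, ∃ y h k, U (WithLp.toLp 2 (x, z • h)) = WithLp.toLp 2 (y, h) ∧
      V (WithLp.toLp 2 (x, z • k)) = WithLp.toLp 2 (y, k)) : SameMarkov U V := by
  have hD : ∀ x, feedthrough U x = feedthrough V x := by
    intro x
    obtain ⟨y, a, b, h1, h2⟩ := h 0 (by simpa using hr) x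
    have h3 := (transfer_eqs h1).1
    have h4 := (transfer_eqs h2).1
    simp only [zero_smul, add_zero] at h3 h4
    rw [← h3, ← h4]
  refine ⟨hD, fun n x => ?_⟩
  set s := min r (1 / 2) with hs
  have hs0 : 0 < s := by positivity
  have h' : ∀ z : ℂ, ‖z‖ < s → ∃ a b, a = inputOp U x + z • stateOp U a ∧
      b = inputOp V x + z • stateOp V b ∧ ‖a‖ ≤ 2 * ‖x‖ ∧ ‖b‖ ≤ 2 * ‖x‖ ∧
      (z ≠ 0 → outputOp U a = outputOp V b) := by
    intro z hz
    obtain ⟨y, a, b, h1, h2⟩ := h z (hz.trans_le (min_le_left _ _)) x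
    have hz2 : ‖z‖ ≤ 1 / 2 := hz.le.trans (min_le_right _ _)
    refine ⟨a, b, (transfer_eqs h1).2, (transfer_eqs h2).2, transfer_norm_le hz2 h1,
      transfer_norm_le hz2 h2, fun hz0 => ?_⟩
    have h3 := (transfer_eqs h1).1
    rw [(transfer_eqs h2).1, hD x] at h3
    -- The common output is `D x + z C a = D x + z C b`; cancelling `z` is why `z ≠ 0` is required.
    exact (smul_right_injective _ hz0 (add_left_cancel h3)).symm
  choose! a b ha hb hna hnb hab using h'
  have step : ∀ n, ∀ z : ℂ, outputOp U ((stateOp U ^ n) (inputOp U x)) +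
        z • outputOp U ((stateOp U ^ (n + 1)) (a z)) =
      outputOp U ((stateOp U ^ n) (inputOp U x + z • stateOp U (a z))) := by
    intro n z
    rw [map_add, map_add, map_smul, map_smul, pow_succ, mul_apply_eq_comp]
  have step' : ∀ n, ∀ z : ℂ, outputOp V ((stateOp V ^ n) (inputOp V x)) +
        z • outputOp V ((stateOp V ^ (n + 1)) (b z)) =
      outputOp V ((stateOp V ^ n) (inputOp V x + z • stateOp V (b z))) := by
    intro n z
    rw [map_add, map_add, map_smul, map_smul, pow_succ, mul_apply_eq_comp]
  -- Since `C Aⁿ a(z) = C Aⁿ B x + O(z)`, equality for small `z ≠ 0` forces equality of the constant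
  -- terms.
  have moment : ∀ n, (∀ z : ℂ, z ≠ 0 → ‖z‖ < s →
      outputOp U ((stateOp U ^ n) (a z)) = outputOp V ((stateOp V ^ n) (b z))) →
      outputOp U ((stateOp U ^ n) (inputOp U x)) = outputOp V ((stateOp V ^ n) (inputOp V x)) := by
    intro n hn
    rw [← sub_eq_zero, ← norm_eq_zero]
    by_contra hne
    set d := ‖outputOp U ((stateOp U ^ n) (inputOp U x)) -
      outputOp V ((stateOp V ^ n) (inputOp V x))‖
    have hd : 0 < d := lt_of_le_of_ne (norm_nonneg _) (Ne.symm hne)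
    -- The two remainders are each bounded by `2‖x‖`, so together they contribute at most `t · 4‖x‖
    -- < d`; the `+ 1` keeps the denominator positive.
    obtain ⟨t, ht0, ht⟩ := exists_between (show 0 < min s (d / (4 * ‖x‖ + 1)) by positivity)
    have hts : ‖(t : ℂ)‖ < s := by
      rw [Complex.norm_of_nonneg ht0.le]
      exact ht.trans_le (min_le_left _ _)
    have e := hn t (by exact_mod_cast ht0.ne') hts
    rw [ha t hts, hb t hts, ← step, ← step'] at e
    have e2 : outputOp U ((stateOp U ^ n) (inputOp U x)) -
        outputOp V ((stateOp V ^ n) (inputOp V x)) =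
        (t : ℂ) • (outputOp V ((stateOp V ^ (n + 1)) (b t)) -
          outputOp U ((stateOp U ^ (n + 1)) (a t))) := by
      rw [smul_sub, sub_eq_sub_iff_add_eq_add, e, add_comm]
    have e3 : d ≤ t * (4 * ‖x‖) := by
      change ‖_‖ ≤ _
      rw [e2, norm_smul, Complex.norm_of_nonneg ht0.le]
      gcongr
      refine (norm_sub_le _ _).trans ?_
      have := (norm_outputOp_le (U := V) ((stateOp V ^ (n + 1)) (b t))).trans
        ((norm_stateOp_pow_le _ _).trans (hnb t hts))
      have := (norm_outputOp_le (U := U) ((stateOp U ^ (n + 1)) (a t))).trans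
        ((norm_stateOp_pow_le _ _).trans (hna t hts))
      linarith
    have e4 : t * (4 * ‖x‖ + 1) < d := (lt_div_iff₀ (by positivity)).1 (ht.trans_le (min_le_right _ _))
    linarith
  -- Removing the equal constant terms and dividing by `z` passes from `n` to `n + 1`.
  have claim : ∀ n, ∀ z : ℂ, z ≠ 0 → ‖z‖ < s →
      outputOp U ((stateOp U ^ n) (a z)) = outputOp V ((stateOp V ^ n) (b z)) := by
    intro n
    induction n with
    | zero => exact fun z hz0 hz => by simpa using hab z hz hz0
    | succ n ih =>
      intro z hz0 hz
      have e := ih z hz0 hz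
      rw [ha z hz, hb z hz, ← step, ← step', moment n ih] at e
      exact smul_right_injective _ hz0 (add_left_cancel e)
  exact moment n (claim n)

end Colligation

/-! ### Square roots and intertwining by defect operators -/

section Intertwining

variable {H₁ H₂ : Type*} [NormedAddCommGroup H₁] [InnerProductSpace ℂ H₁]
  [NormedAddCommGroup H₂] [InnerProductSpace ℂ H₂]

theorem blockOp_diag_nonneg {A : H₁ →L[ℂ] H₁} {B : H₂ →L[ℂ] H₂} (hA : 0 ≤ A) (hB : 0 ≤ B) :
    0 ≤ blockOp A 0 0 B := by
  rw [ContinuousLinearMap.nonneg_iff_isPositive] at hA hB ⊢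
  refine ⟨fun x y => ?_, fun x => ?_⟩
  · have h1 := hA.1 x.fst y.fst
    have h2 := hB.1 x.snd y.snd
    change inner ℂ (A x.fst + 0) y.fst + inner ℂ (0 + B x.snd) y.snd =
      inner ℂ x.fst (A y.fst + 0) + inner ℂ x.snd (0 + B y.snd)
    rw [add_zero, add_zero, zero_add, zero_add]
    exact congrArg₂ _ h1 h2
  · have h1 := hA.2 x.fst
    have h2 := hB.2 x.snd
    change 0 ≤ RCLike.re (inner ℂ (A x.fst + 0) x.fst + inner ℂ (0 + B x.snd) x.snd : ℂ)
    rw [add_zero, zero_add, map_add]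
    exact add_nonneg h1 h2

variable [CompleteSpace H₁] [CompleteSpace H₂]

/-- A positive `Q` is the square root of `Q²`, hence a function of `Q²` in the functional calculus.
-/
theorem commute_of_commute_mul_self {Q N : H₁ →L[ℂ] H₁} (hQ : 0 ≤ Q) (h : Commute (Q * Q) N) :
    Commute Q N := by
  rw [← CFC.sqrt_mul_self Q hQ]
  exact h.cfcₙ_nnreal _

/-- Positive square roots inherit intertwining relations. -/
theorem intertwine_of_sq {A : H₁ →L[ℂ] H₁} {B : H₂ →L[ℂ] H₂} (hA : 0 ≤ A) (hB : 0 ≤ B)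
    {G : H₁ →L[ℂ] H₂} (h : ∀ x, G (A (A x)) = B (B (G x))) (x : H₁) : G (A x) = B (G x) := by
  -- Placing `G` off the diagonal on `H₁ ⊕ H₂` turns intertwining into commutation with `A ⊕ B`.
  have hc : Commute (blockOp A 0 0 B * blockOp A 0 0 B) (blockOp 0 0 G 0) := by
    refine ContinuousLinearMap.ext fun p => ?_
    change WithLp.toLp 2 (A (A (0 + 0) + 0) + 0, 0 + B (0 + B (G p.fst + 0))) =
      WithLp.toLp 2 (0 + 0, G (A (A p.fst + 0) + 0) + 0)
    simp only [add_zero, zero_add, map_zero, h]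
  have h3 := congrArg (fun T => (T (WithLp.toLp 2 (x, (0 : H₂)))).snd)
    (commute_of_commute_mul_self (blockOp_diag_nonneg hA hB) hc).eq
  change 0 + B (G x + 0) = G (A x + 0) + 0 at h3
  simpa using h3.symm

theorem defectOp_defectOp {T : H₁ →L[ℂ] H₂} (hT : ‖T‖ ≤ 1) (x : H₁) :
    defectOp T (defectOp T x) = x - ContinuousLinearMap.adjoint T (T x) := by
  simpa [defectOp] using congrArg (fun A : H₁ →L[ℂ] H₁ => A x)
    (CFC.sqrt_mul_sqrt_self _ (one_sub_nonneg hT))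

/-- The square root of the obvious relation `T (I - T* T) = (I - T T*) T`. -/
theorem apply_defectOp {T : H₁ →L[ℂ] H₂} (hT : ‖T‖ ≤ 1) (x : H₁) :
    T (defectOp T x) = defectOp (ContinuousLinearMap.adjoint T) (T x) := by
  have hT' : ‖ContinuousLinearMap.adjoint T‖ ≤ 1 := by simpa using hT
  refine intertwine_of_sq (A := defectOp T) (B := defectOp (ContinuousLinearMap.adjoint T))
    (CFC.sqrt_nonneg _) (CFC.sqrt_nonneg _) (fun y => ?_) x
  rw [defectOp_defectOp hT, defectOp_defectOp hT',
    ContinuousLinearMap.adjoint_adjoint, map_sub]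

theorem inner_defectOp_left (T : H₁ →L[ℂ] H₂) (x y : H₁) :
    inner ℂ (defectOp T x) y = inner ℂ x (defectOp T y) := by
  rw [← ContinuousLinearMap.adjoint_inner_right, defectOp_isSelfAdjoint]

theorem eq_zero_of_mem_defectSpace {T : H₁ →L[ℂ] H₂} {x : H₁} (hx : x ∈ defectSpace T)
    (h : defectOp T x = 0) : x = 0 :=
  inner_self_eq_zero.1 ((mem_defectSpace_iff T x).1 hx x h)

end Intertwining

/-! ### Elementary rotations are unitary -/

namespace ChoiceSequence

variable {𝔐 𝔑 : Type*} [NormedAddCommGroup 𝔐] [InnerProductSpace ℂ 𝔐]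
  [NormedAddCommGroup 𝔑] [InnerProductSpace ℂ 𝔑] (S : ChoiceSequence 𝔐 𝔑)

theorem norm_adjoint_le (n : ℕ) : ‖ContinuousLinearMap.adjoint (S.Γ n)‖ ≤ 1 := by
  simpa using S.contraction n

theorem rot_toLp (n : ℕ) (x : S.M n) (y : S.N (n + 1)) :
    S.rot n (WithLp.toLp 2 (x, y)) =
      WithLp.toLp 2 (S.Γ n x + S.defectStar n y, S.defect n x - S.adjRestrict n y) := by
  rw [sub_eq_add_neg]
  rfl

/-- The defect subspace is the orthogonal complement of the kernel of the defect operator. -/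
theorem defectStar_injective (n : ℕ) {y : S.N (n + 1)} (h : S.defectStar n y = 0) : y = 0 := by
  have h1 : S.inclN n y = 0 := eq_zero_of_mem_defectSpace (S.inclN_mem n y) h
  have h2 : (S.inclN n y : 𝔑) = 0 := by rw [h1]; rfl
  exact Subtype.ext h2

theorem inner_defect_left (n : ℕ) (x : S.M n) (y : S.M (n + 1)) :
    inner ℂ (S.defect n x) y = inner ℂ x (S.adjoint.defectStar n y) := by
  have h1 := inner_defectOp_left (S.Γ n) x (S.adjoint.inclN n y)
  have h2 : S.adjoint.defectStar n y = defectOp (S.Γ n) (S.adjoint.inclN n y) :=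
    congrArg (fun A => defectOp A (S.adjoint.inclN n y))
      (ContinuousLinearMap.adjoint_adjoint (S.Γ n))
  rw [h2]
  exact h1

theorem inner_defectStar_left (n : ℕ) (x : S.N (n + 1)) (y : S.N n) :
    inner ℂ (S.defectStar n x) y = inner ℂ x (S.adjoint.defect n y) := by
  change inner ℂ (defectOp (ContinuousLinearMap.adjoint (S.Γ n)) (S.inclN n x)) y =
    inner ℂ (S.inclN n x) (defectOp (ContinuousLinearMap.adjoint (S.Γ n)) y)
  rw [inner_defectOp_left]

theorem inner_adjRestrict_left (n : ℕ) (x : S.N (n + 1)) (y : S.M (n + 1)) :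
    inner ℂ (S.adjRestrict n x) y = inner ℂ x (S.adjoint.adjRestrict n y) := by
  have h1 := ContinuousLinearMap.adjoint_inner_left (S.Γ n) (S.adjoint.inclN n y) (S.inclN n x)
  exact h1.trans (congrArg (fun A => inner ℂ (S.inclN n x) (A (S.adjoint.inclN n y)))
    (ContinuousLinearMap.adjoint_adjoint (S.Γ n)).symm)

/-- Entry by entry, `(J_Γ)* = J_{Γ*}`: the adjoint choice sequence provides the adjoint rotations.
-/
theorem inner_rot_left (n : ℕ) (p : WithLp 2 (S.M n × S.N (n + 1)))
    (q : WithLp 2 (S.N n × S.M (n + 1))) :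
    inner ℂ (S.rot n p) q = inner ℂ p (S.adjoint.rot n q) := by
  obtain ⟨x, y⟩ := p
  obtain ⟨u, v⟩ := q
  have e1 := S.rot_toLp n x y
  have e2 := S.adjoint.rot_toLp n u v
  have h1 := S.inner_defect_left n x v
  have h2 := S.inner_defectStar_left n y u
  have h3 := S.inner_adjRestrict_left n y v
  have h4 : inner ℂ (S.Γ n x) u = inner ℂ x (S.adjoint.Γ n u) :=
    (ContinuousLinearMap.adjoint_inner_right _ _ _).symm
  have h5 : inner ℂ x (S.adjoint.Γ n u + S.adjoint.defectStar n v) =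
      inner ℂ x (S.adjoint.Γ n u) + inner ℂ x (S.adjoint.defectStar n v) := inner_add_right _ _ _
  have h6 : inner ℂ y (S.adjoint.defect n u - S.adjoint.adjRestrict n v) =
      inner ℂ y (S.adjoint.defect n u) - inner ℂ y (S.adjoint.adjRestrict n v) :=
    inner_sub_right _ _ _
  change inner ℂ (S.rot n (WithLp.toLp 2 (x, y))) (WithLp.toLp 2 (u, v)) =
    inner ℂ (WithLp.toLp 2 (x, y)) (S.adjoint.rot n (WithLp.toLp 2 (u, v)))
  rw [e1, e2]
  refine (inner_toLp_prod _ _ _ _).trans (Eq.trans ?_ (inner_toLp_prod _ _ _ _).symm)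
  rw [inner_add_left, inner_sub_left, h1, h2, h3, h4]
  refine Eq.trans ?_ (congrArg₂ (· + ·) h5 h6).symm
  ring

/-- The cross terms cancel because `Γ D_Γ = D_{Γ*} Γ` gives `⟨Γ x, D_{Γ*} y⟩ = ⟨D_Γ x, Γ* y⟩`; the
diagonal terms add up by the definition of the defect operators. -/
theorem norm_rot (n : ℕ) (p : WithLp 2 (S.M n × S.N (n + 1))) : ‖S.rot n p‖ = ‖p‖ := by
  obtain ⟨x, y⟩ := p
  have hx := defectOp_norm_sq (S.contraction n) x
  have hy := defectOp_norm_sq (S.norm_adjoint_le n) (S.inclN n y)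
  have hc : (inner ℂ (S.Γ n x) (S.defectStar n y) : ℂ) =
      inner ℂ (S.defect n x) (S.adjRestrict n y) := by
    change (inner ℂ (S.Γ n x) (defectOp (ContinuousLinearMap.adjoint (S.Γ n)) (S.inclN n y)) : ℂ) =
      inner ℂ (defectOp (S.Γ n) x) (ContinuousLinearMap.adjoint (S.Γ n) (S.inclN n y))
    rw [ContinuousLinearMap.adjoint_inner_right, apply_defectOp (S.contraction n),
      inner_defectOp_left]
  rw [← sq_eq_sq₀ (norm_nonneg _) (norm_nonneg _)]
  change ‖S.rot n (WithLp.toLp 2 (x, y))‖ ^ 2 = ‖WithLp.toLp 2 (x, y)‖ ^ 2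
  rw [rot_toLp, WithLp.prod_norm_sq_eq_of_L2, WithLp.prod_norm_sq_eq_of_L2]
  change ‖S.Γ n x + S.defectStar n y‖ ^ 2 + ‖S.defect n x - S.adjRestrict n y‖ ^ 2 =
    ‖x‖ ^ 2 + ‖y‖ ^ 2
  rw [norm_add_sq (𝕜 := ℂ), norm_sub_sq (𝕜 := ℂ), hc]
  have h1 : ‖S.defect n x‖ = ‖defectOp (S.Γ n) x‖ := rfl
  have h2 : ‖S.defectStar n y‖ =
    ‖defectOp (ContinuousLinearMap.adjoint (S.Γ n)) (S.inclN n y)‖ := rfl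
  have h3 : ‖S.adjRestrict n y‖ = ‖ContinuousLinearMap.adjoint (S.Γ n) (S.inclN n y)‖ := rfl
  have h4 : ‖y‖ = ‖S.inclN n y‖ := rfl
  rw [h1, h2, h3, h4]
  linarith

theorem adjoint_rot_rot (n : ℕ) (p : WithLp 2 (S.M n × S.N (n + 1))) :
    S.adjoint.rot n (S.rot n p) = p := by
  refine ext_inner_left ℂ fun q => ?_
  have h1 := S.inner_rot_left n q (S.rot n p)
  have h2 := (LinearMap.norm_map_iff_inner_map_map (S.rot n)).1 (S.norm_rot n) q p
  exact h1.symm.trans h2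

/-- Surjectivity of `J_Γ` comes from the fact that its adjoint `J_{Γ*}` is isometric too. -/
theorem rot_adjoint_rot (n : ℕ) (q : WithLp 2 (S.N n × S.M (n + 1))) :
    S.rot n (S.adjoint.rot n q) = q := by
  refine ext_inner_right ℂ fun p => ?_
  have h1 := S.inner_rot_left n (S.adjoint.rot n q) p
  have h2 := (LinearMap.norm_map_iff_inner_map_map (S.adjoint.rot n)).1 (S.adjoint.norm_rot n) q p
  exact h1.trans h2

/-! ### Unitarity of the block operator CMV matrices -/

theorem adjoint_opV_opV (f : S.StateSpace) : S.adjoint.opV (S.opV f) = f := by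
  refine Subtype.ext (funext fun n => ?_)
  exact S.adjoint_rot_rot (2 * n + 1) (f n)

theorem opV_adjoint_opV (f : S.StateSpaceTilde) : S.opV (S.adjoint.opV f) = f := by
  refine Subtype.ext (funext fun n => ?_)
  exact S.rot_adjoint_rot (2 * n + 1) (f n)

theorem norm_directSumOp {X Y : ℕ → Type*} [∀ n, NormedAddCommGroup (X n)]
    [∀ n, InnerProductSpace ℂ (X n)] [∀ n, NormedAddCommGroup (Y n)]
    [∀ n, InnerProductSpace ℂ (Y n)] (A : ∀ n, X n →L[ℂ] Y n) (C : ℝ) (hC : 0 ≤ C)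
    (hA : ∀ n x, ‖A n x‖ ≤ C * ‖x‖) (h : ∀ n x, ‖A n x‖ = ‖x‖) (f : lp X 2) :
    ‖directSumOp A C hC hA f‖ = ‖f‖ := by
  rw [← sq_eq_sq₀ (norm_nonneg _) (norm_nonneg _)]
  refine (hasSum_norm_sq _).unique (hasSum_congr_aux (hasSum_norm_sq f) fun n => ?_)
  rw [directSumOp_apply, h]

/-- `V₀` as a unitary operator. -/
def unitaryV : S.StateSpace ≃ₗᵢ[ℂ] S.StateSpaceTilde where
  toFun := S.opV
  invFun := S.adjoint.opV
  map_add' := map_add _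
  map_smul' := map_smul _
  left_inv := S.adjoint_opV_opV
  right_inv := S.opV_adjoint_opV
  norm_map' := norm_directSumOp _ _ zero_le_two (fun n => S.rot_bound (2 * n + 1))
    fun n => S.norm_rot (2 * n + 1)

/-- `∑ₙ ⊕ J_{Γ 2n}`. -/
def sumRotEven : lp (fun n : ℕ => WithLp 2 (S.M (2 * n) × S.N (2 * n + 1))) 2 →L[ℂ]
    lp (fun n : ℕ => WithLp 2 (S.N (2 * n) × S.M (2 * n + 1))) 2 :=
  directSumOp (X := fun n : ℕ => WithLp 2 (S.M (2 * n) × S.N (2 * n + 1)))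
    (Y := fun n : ℕ => WithLp 2 (S.N (2 * n) × S.M (2 * n + 1)))
    (fun n => S.rot (2 * n)) 2 zero_le_two (fun n => S.rot_bound (2 * n))

theorem opL_apply (x : WithLp 2 (S.M 0 × S.StateSpaceTilde)) :
    S.opL x = (regroup (fun n => S.N (2 * n)) (fun n => S.M (2 * n + 1))).symm
      (S.sumRotEven (regroup (fun n => S.M (2 * n)) (fun n => S.N (2 * n + 1)) x)) := rfl

/-- Regrouping both sides makes `ℒ₀` block diagonal, so equations for it can be checked one rotation
at a time. -/
theorem opL_eq_iff (x : WithLp 2 (S.M 0 × S.StateSpaceTilde))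
    (y : WithLp 2 (S.N 0 × S.StateSpace)) :
    S.opL x = y ↔ ∀ n, S.rot (2 * n)
      (regroup (fun n => S.M (2 * n)) (fun n => S.N (2 * n + 1)) x n) =
      regroup (fun n => S.N (2 * n)) (fun n => S.M (2 * n + 1)) y n := by
  rw [opL_apply, LinearIsometryEquiv.symm_apply_eq]
  constructor
  · intro h n
    rw [← h]
    rfl
  · intro h
    exact Subtype.ext (funext h)

theorem adjoint_opL_opL (x : WithLp 2 (S.M 0 × S.StateSpaceTilde)) :
    S.adjoint.opL (S.opL x) = x := by
  refine (S.adjoint.opL_eq_iff _ _).2 fun n => ?_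
  have h := (S.opL_eq_iff x (S.opL x)).1 rfl n
  have h2 := S.adjoint_rot_rot (2 * n)
    (regroup (fun n => S.M (2 * n)) (fun n => S.N (2 * n + 1)) x n)
  rw [h] at h2
  exact h2

theorem opL_adjoint_opL (x : WithLp 2 (S.N 0 × S.StateSpace)) :
    S.opL (S.adjoint.opL x) = x := by
  refine (S.opL_eq_iff _ _).2 fun n => ?_
  have h := (S.adjoint.opL_eq_iff x (S.adjoint.opL x)).1 rfl n
  have h2 := S.rot_adjoint_rot (2 * n)
    (regroup (fun n => S.N (2 * n)) (fun n => S.M (2 * n + 1)) x n)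
  refine Eq.trans ?_ h2
  exact congrArg (S.rot (2 * n)) h.symm

theorem norm_opL (x : WithLp 2 (S.M 0 × S.StateSpaceTilde)) : ‖S.opL x‖ = ‖x‖ := by
  rw [opL_apply, LinearIsometryEquiv.norm_map]
  exact (norm_directSumOp _ _ zero_le_two (fun n => S.rot_bound (2 * n))
    (fun n => S.norm_rot (2 * n)) _).trans
    (LinearIsometryEquiv.norm_map _ _)

theorem opM_toLp (x : S.M 0) (h : S.StateSpace) :
    S.opM (WithLp.toLp 2 (x, h)) = WithLp.toLp 2 (x, S.opV h) := by
  change WithLp.toLp 2 (x + 0, 0 + S.opV h) = _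
  rw [add_zero, zero_add]

theorem opMTilde_toLp (x : S.N 0) (h : S.StateSpace) :
    S.opMTilde (WithLp.toLp 2 (x, h)) = WithLp.toLp 2 (x, S.opV h) := by
  change WithLp.toLp 2 (x + 0, 0 + S.opV h) = _
  rw [add_zero, zero_add]

theorem adjoint_opMTilde_opM (x : WithLp 2 (S.M 0 × S.StateSpace)) :
    S.adjoint.opMTilde (S.opM x) = x := by
  change S.adjoint.opMTilde (S.opM (WithLp.toLp 2 (x.fst, x.snd))) = WithLp.toLp 2 (x.fst, x.snd)
  rw [opM_toLp]
  refine (S.adjoint.opMTilde_toLp x.fst (S.opV x.snd)).trans ?_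
  rw [adjoint_opV_opV]
  rfl

theorem opM_adjoint_opMTilde (x : WithLp 2 (S.M 0 × S.StateSpaceTilde)) :
    S.opM (S.adjoint.opMTilde x) = x := by
  change S.opM (S.adjoint.opMTilde (WithLp.toLp 2 (x.fst, x.snd))) = WithLp.toLp 2 (x.fst, x.snd)
  refine (congrArg S.opM (S.adjoint.opMTilde_toLp x.fst x.snd)).trans ?_
  refine (S.opM_toLp x.fst (S.adjoint.opV x.snd)).trans ?_
  rw [opV_adjoint_opV]

theorem norm_opM (x : WithLp 2 (S.M 0 × S.StateSpace)) : ‖S.opM x‖ = ‖x‖ := by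
  change ‖S.opM (WithLp.toLp 2 (x.fst, x.snd))‖ = ‖WithLp.toLp 2 (x.fst, x.snd)‖
  rw [opM_toLp, ← sq_eq_sq₀ (norm_nonneg _) (norm_nonneg _), WithLp.prod_norm_sq_eq_of_L2,
    WithLp.prod_norm_sq_eq_of_L2]
  exact congrArg (fun t : ℝ => ‖x.fst‖ ^ 2 + t ^ 2) (S.unitaryV.norm_map x.snd)

/-- The block operator CMV matrix `𝒰₀` as a unitary operator, with inverse the matrix `𝒰̃₀` of the
adjoint choice sequence. -/
def unitaryCMV : WithLp 2 (S.M 0 × S.StateSpace) ≃ₗᵢ[ℂ] WithLp 2 (S.N 0 × S.StateSpace) where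
  toFun := S.cmv
  invFun := S.adjoint.cmvTilde
  map_add' := map_add _
  map_smul' := map_smul _
  left_inv x := (congrArg S.adjoint.opMTilde (S.adjoint_opL_opL (S.opM x))).trans
    (S.adjoint_opMTilde_opM x)
  right_inv x := (congrArg S.opL (S.opM_adjoint_opMTilde (S.adjoint.opL x))).trans
    (S.opL_adjoint_opL x)
  norm_map' x := (S.norm_opL (S.opM x)).trans (S.norm_opM x)

/-- This is where the adjoint parameters and the tilde enter: `(ℒ₀ ℳ₀)⁻¹` is the product of the
inverse factors in reverse order, with every rotation replaced by its adjoint. -/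
theorem stateOp_unitaryCMV_symm : stateOp S.unitaryCMV.symm = S.adjoint.truncatedCMVTilde := rfl

/-- The two truncated block operator CMV matrices are unitarily equivalent through `V₀`. -/
theorem opV_truncatedCMV (h : S.StateSpace) :
    S.opV (S.truncatedCMV h) = S.truncatedCMVTilde (S.opV h) := by
  have h1 : S.truncatedCMV h = (S.opL (WithLp.toLp 2 (0, S.opV h))).snd := by
    rw [← opM_toLp]
    rfl
  have h2 : S.truncatedCMVTilde (S.opV h) =
      (S.opMTilde (S.opL (WithLp.toLp 2 (0, S.opV h)))).snd := rfl
  rw [h1, h2]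
  exact (congrArg WithLp.snd (S.opMTilde_toLp _ _)).symm

end ChoiceSequence

namespace ChoiceSequence

variable {𝔐 𝔑 : Type*} [NormedAddCommGroup 𝔐] [InnerProductSpace ℂ 𝔐]
  [NormedAddCommGroup 𝔑] [InnerProductSpace ℂ 𝔑] (S : ChoiceSequence 𝔐 𝔑)

/-! ### Simplicity of the CMV colligation -/

/-- The even rotations straddle the blocks of the state space: `J_{Γ 0}` links the outer spaces to
block `0`, and `J_{Γ (2n+2)}` links the second entry of block `n` to the first entry of block `n +
1`. -/
theorem unitaryCMV_eq_iff (x : S.M 0) (y : S.N 0) (h k : S.StateSpace) :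
    S.unitaryCMV (WithLp.toLp 2 (x, h)) = WithLp.toLp 2 (y, k) ↔
      S.rot 0 (WithLp.toLp 2 (x, (S.opV h 0).fst)) = WithLp.toLp 2 (y, (k 0).fst) ∧
      ∀ n, S.rot (2 * (n + 1)) (WithLp.toLp 2 ((S.opV h n).snd, (S.opV h (n + 1)).fst)) =
        WithLp.toLp 2 ((k n).snd, (k (n + 1)).fst) := by
  change S.opL (S.opM (WithLp.toLp 2 (x, h))) = _ ↔ _
  rw [opM_toLp, opL_eq_iff]
  constructor
  · exact fun H => ⟨H 0, fun n => H (n + 1)⟩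
  · rintro ⟨h0, hs⟩ (_ | n)
    · exact h0
    · exact hs n

theorem rot_eq_zero_of_fst_eq_zero (n : ℕ) {r : S.N (n + 1)} {q : WithLp 2 (S.N n × S.M (n + 1))}
    (h : S.rot n (WithLp.toLp 2 (0, r)) = q) (hq : q.fst = 0) : r = 0 ∧ q = 0 := by
  have hr : r = 0 := by
    refine S.defectStar_injective n ?_
    rw [← h, rot_toLp] at hq
    simpa using hq
  refine ⟨hr, ?_⟩
  rw [← h, hr]
  exact map_zero _

theorem opV_apply (h : S.StateSpace) (n : ℕ) : S.opV h n = S.rot (2 * n + 1) (h n) := rfl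

theorem opV_apply_eq_zero (h : S.StateSpace) (n : ℕ) (hn : h n = 0) : S.opV h n = 0 := by
  rw [opV_apply, hn]
  exact map_zero _

theorem state_apply_eq_zero (h : S.StateSpace) (n : ℕ) (h1 : (h n).fst = 0)
    (h2 : (S.opV h n).fst = 0) : h n = 0 := by
  have e : h n = WithLp.toLp 2 (0, (h n).snd) := by
    rw [← h1]
    rfl
  rw [opV_apply, e] at h2
  have := (S.rot_eq_zero_of_fst_eq_zero (2 * n + 1) rfl h2).1
  rw [e]
  exact congrArg (fun t => WithLp.toLp 2 ((0 : S.M (2 * n + 1)), t)) this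

/-- The CMV colligation is simple. -/
theorem isSimple_unitaryCMV : IsSimple S.unitaryCMV := by
  refine isSimple_of_forall_reducing _ fun L _ hA hA' hC hC' => ?_
  have hmap : ∀ h ∈ L, S.unitaryCMV (WithLp.toLp 2 (0, h)) =
      WithLp.toLp 2 (0, stateOp S.unitaryCMV h) := fun h hh => by
    rw [colligation_state, hC h hh]
  -- `A A* = I - B B*` and `B*` vanishes on `L`, so `A` maps `L` onto itself.
  have hsurj : ∀ h ∈ L, ∃ g ∈ L, stateOp S.unitaryCMV g = h := fun h hh => by
    refine ⟨_, hA' h hh, ?_⟩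
    rw [stateOp_stateOp_symm, hC' h hh, inputOp]
    have : WithLp.toLp 2 ((0 : S.M 0), (0 : S.StateSpace)) = 0 := rfl
    rw [this, map_zero]
    exact sub_zero h
  -- Zeros propagate from block to block. An even rotation with vanishing first input and first
  -- output kills the first entry of block `n` of both `V₀ h` and `A h`. Since every `h` in `L` is
  -- some `A g`, its own first entry vanishes, and then the odd rotation kills the second.
  have key : ∀ n, ∀ h ∈ L, h n = 0 := by
    intro n
    induction n with
    | zero =>
      have h0 : ∀ h ∈ L, (S.opV h 0).fst = 0 ∧ (stateOp S.unitaryCMV h 0).fst = 0 := by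
        intro h hh
        have e := ((S.unitaryCMV_eq_iff _ _ _ _).1 (hmap h hh)).1
        have := S.rot_eq_zero_of_fst_eq_zero 0 e rfl
        exact ⟨this.1, congrArg WithLp.snd this.2⟩
      intro h hh
      obtain ⟨g, hg, rfl⟩ := hsurj h hh
      exact S.state_apply_eq_zero _ 0 (h0 g hg).2 (h0 _ hh).1
    | succ n ih =>
      have h0 : ∀ h ∈ L, (S.opV h (n + 1)).fst = 0 ∧
          (stateOp S.unitaryCMV h (n + 1)).fst = 0 := by
        intro h hh
        have e := ((S.unitaryCMV_eq_iff _ _ _ _).1 (hmap h hh)).2 n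
        rw [S.opV_apply_eq_zero h n (ih h hh), ih _ (hA h hh)] at e
        have := S.rot_eq_zero_of_fst_eq_zero (2 * (n + 1)) e rfl
        exact ⟨this.1, congrArg WithLp.snd this.2⟩
      intro h hh
      obtain ⟨g, hg, rfl⟩ := hsurj h hh
      exact S.state_apply_eq_zero _ (n + 1) (h0 g hg).2 (h0 _ hh).1
  rw [eq_bot_iff]
  intro h hh
  exact Subtype.ext (funext fun n => key n h hh)

/-! ### The transfer function of the CMV colligation -/

/-- Each isometric rotation gives `‖u (n+1)‖² ≤ ‖u n‖² + ‖u (n+1)‖² / 4`, whence the ratio `4/3`. -/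
theorem norm_sq_le_of_recursion {z : ℂ} (hz : ‖z‖ ≤ 1 / 2) {u : ∀ n, S.M n} {y : ∀ n, S.N n}
    (hrot : ∀ n, S.rot n (WithLp.toLp 2 (u n, z • y (n + 1))) = WithLp.toLp 2 (y n, u (n + 1)))
    (hy : ∀ n, ‖y n‖ ≤ ‖u n‖) (n : ℕ) : ‖u n‖ ^ 2 ≤ (4 / 3) ^ n * ‖u 0‖ ^ 2 := by
  induction n with
  | zero => simp
  | succ n ih =>
    have h1 := S.norm_rot n (WithLp.toLp 2 (u n, z • y (n + 1)))
    rw [hrot, ← sq_eq_sq₀ (norm_nonneg _) (norm_nonneg _), WithLp.prod_norm_sq_eq_of_L2,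
      WithLp.prod_norm_sq_eq_of_L2] at h1
    change ‖y n‖ ^ 2 + ‖u (n + 1)‖ ^ 2 = ‖u n‖ ^ 2 + ‖z • y (n + 1)‖ ^ 2 at h1
    have h2 : ‖z • y (n + 1)‖ ≤ 1 / 2 * ‖u (n + 1)‖ := by
      rw [norm_smul]
      gcongr
      exact hy _
    have h3 : ‖z • y (n + 1)‖ ^ 2 ≤ (1 / 2 * ‖u (n + 1)‖) ^ 2 := by gcongr
    have e : (4 / 3 : ℝ) ^ (n + 1) * ‖u 0‖ ^ 2 = 4 / 3 * ((4 / 3) ^ n * ‖u 0‖ ^ 2) := by ring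
    rw [e]
    nlinarith [sq_nonneg ‖y n‖]

/-- A solution of the recursion `J_{Γ n} (u n, z y (n+1)) = (y n, u (n+1))` yields
a solution of the state equations of the CMV colligation. -/
theorem exists_state_of_recursion {z : ℂ} (hz : ‖z‖ ≤ 1 / 2) {u : ∀ n, S.M n} {y : ∀ n, S.N n}
    (hrot : ∀ n, S.rot n (WithLp.toLp 2 (u n, z • y (n + 1))) = WithLp.toLp 2 (y n, u (n + 1)))
    (hy : ∀ n, ‖y n‖ ≤ ‖u n‖) :
    ∃ h, S.unitaryCMV (WithLp.toLp 2 (u 0, z • h)) = WithLp.toLp 2 (y 0, h) := by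
  have hu := S.norm_sq_le_of_recursion hz hrot hy
  -- One pass through `𝒰₀` applies two layers of rotations but carries a single factor `z`; the
  -- weights `zⁿ` per block compensate for this.
  let h : ∀ n : ℕ, WithLp 2 (S.M (2 * n + 1) × S.N (2 * (n + 1))) := fun n =>
    WithLp.toLp 2 (z ^ n • u (2 * n + 1), z ^ (n + 1) • y (2 * (n + 1)))
  have hpow : ∀ n : ℕ, (‖z‖ ^ n) ^ 2 ≤ (1 / 4) ^ n := fun n => by
    rw [← pow_mul, mul_comm, pow_mul]
    gcongr
    nlinarith [norm_nonneg z]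
  have hmem : Memℓp h 2 := by
    rw [memℓp_two_iff]
    -- The decay `|z|²ⁿ ≤ 4⁻ⁿ` beats the growth `(4/3)²ⁿ`, with ratio `4/9`; the two entries
    -- contribute the factors `4/3` and `4/9`, whose sum is below `2`.
    refine Summable.of_nonneg_of_le (fun n => by positivity) (fun n => ?_)
      ((summable_geometric_of_lt_one (show (0 : ℝ) ≤ 4 / 9 by norm_num)
        (by norm_num)).mul_right (2 * ‖u 0‖ ^ 2))
    rw [WithLp.prod_norm_sq_eq_of_L2]
    change ‖z ^ n • u (2 * n + 1)‖ ^ 2 + ‖z ^ (n + 1) • y (2 * (n + 1))‖ ^ 2 ≤ _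
    rw [norm_smul, norm_smul, mul_pow, mul_pow, norm_pow, norm_pow]
    have h1 := mul_le_mul (hpow n) (hu (2 * n + 1)) (by positivity) (by positivity)
    have h2 := mul_le_mul (hpow (n + 1)) ((pow_le_pow_left₀ (norm_nonneg _)
      (hy (2 * (n + 1))) 2).trans (hu (2 * (n + 1)))) (by positivity) (by positivity)
    refine (add_le_add h1 h2).trans ?_
    have e : (4 / 9 : ℝ) ^ n = (1 / 4) ^ n * (4 / 3) ^ (2 * n) := by
      rw [pow_mul, ← mul_pow]
      norm_num
    have e1 : (4 / 3 : ℝ) ^ (2 * (n + 1)) = (4 / 3) ^ (2 * n) * (16 / 9) := by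
      rw [mul_add, pow_add]
      norm_num
    rw [e, e1, pow_succ _ n, pow_succ _ (2 * n)]
    have : 0 ≤ (1 / 4 : ℝ) ^ n * (4 / 3) ^ (2 * n) * ‖u 0‖ ^ 2 := by positivity
    linarith
  have hV : ∀ n, S.opV (z • (⟨h, hmem⟩ : S.StateSpace)) n =
      WithLp.toLp 2 (z ^ (n + 1) • y (2 * n + 1), z ^ (n + 1) • u (2 * (n + 1))) := by
    intro n
    have e1 : S.opV (z • (⟨h, hmem⟩ : S.StateSpace)) n = z • S.rot (2 * n + 1) (h n) := by
      rw [map_smul]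
      rfl
    have e2 : h n = z ^ n • WithLp.toLp 2 (u (2 * n + 1), z • y (2 * (n + 1))) := by
      rw [← WithLp.toLp_smul, Prod.smul_mk, smul_smul, ← pow_succ]
    have e3 := congrArg (fun t => z ^ (n + 1) • t) (hrot (2 * n + 1))
    rw [e1, e2, map_smul, smul_smul, ← pow_succ']
    exact e3
  refine ⟨⟨h, hmem⟩, (S.unitaryCMV_eq_iff _ _ _ _).2 ⟨?_, fun n => ?_⟩⟩
  · have e1 : (S.opV (z • (⟨h, hmem⟩ : S.StateSpace)) 0).fst = z • y 1 := by
      rw [hV]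
      change z ^ (0 + 1) • y 1 = _
      rw [zero_add, pow_one]
    have e2 : ((⟨h, hmem⟩ : S.StateSpace) 0).fst = u 1 := by
      change z ^ 0 • u 1 = _
      rw [pow_zero, one_smul]
    exact (congrArg (fun t => S.rot 0 (WithLp.toLp 2 (u 0, t))) e1).trans
      ((hrot 0).trans (congrArg (fun t => WithLp.toLp 2 (y 0, t)) e2.symm))
  · rw [hV, hV]
    have e3 : S.rot (2 * (n + 1)) (z ^ (n + 1) •
        WithLp.toLp 2 (u (2 * (n + 1)), z • y (2 * (n + 1) + 1))) =
        z ^ (n + 1) • WithLp.toLp 2 (y (2 * (n + 1)), u (2 * (n + 1) + 1)) := by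
      rw [map_smul, hrot]
    rw [← WithLp.toLp_smul, Prod.smul_mk, smul_smul, ← pow_succ] at e3
    exact e3

/-- A Neumann series argument. -/
theorem isUnit_one_add_of_norm_lt_one {E : Type*} [NormedAddCommGroup E] [InnerProductSpace ℂ E]
    [CompleteSpace E] {A : E →L[ℂ] E} (hA : ‖A‖ < 1) : IsUnit (1 + A) := by
  rw [← sub_neg_eq_add]
  exact isUnit_one_sub_of_norm_lt_one (by rwa [norm_neg])

theorem norm_adjRestrict_le (n : ℕ) : ‖S.adjRestrict n‖ ≤ 1 := by
  refine ContinuousLinearMap.opNorm_le_bound _ zero_le_one fun x => ?_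
  exact (ContinuousLinearMap.adjoint (S.Γ n)).le_of_opNorm_le (S.norm_adjoint_le n) (S.inclN n x)

/-- The function with Schur parameters `Γ n` is the transfer function of the CMV colligation. -/
theorem IsSchurParameters.exists_state {S : ChoiceSequence 𝔐 𝔑} {Φ : ℂ → 𝔐 →L[ℂ] 𝔑}
    (hS : S.IsSchurParameters Φ) {z : ℂ} (hz : ‖z‖ ≤ 1 / 2) (x : S.M 0) :
    ∃ (y : S.N 0) (h : S.StateSpace), (y : 𝔑) = Φ z x ∧
      S.unitaryCMV (WithLp.toLp 2 (x, z • h)) = WithLp.toLp 2 (y, h) := by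
  obtain ⟨Θ, hΘ, h0, -, hstep⟩ := hS
  have hzb : z ∈ Metric.ball (0 : ℂ) 1 := by
    rw [mem_ball_zero_iff]
    linarith
  -- With outputs `y n = Θ n z (u n)`, the resolvent factor of the Schur step becomes the second
  -- component of the rotation equation, and the rest of the formula its first component.
  let u : ∀ n, S.M n := fun n => Nat.rec x (fun n v =>
    Ring.inverse (1 + S.adjRestrict n ∘L (z • Θ (n + 1) z)) (S.defect n v)) n
  have hu : ∀ n, u (n + 1) =
    Ring.inverse (1 + S.adjRestrict n ∘L (z • Θ (n + 1) z)) (S.defect n (u n)) := fun n => rfl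
  have hinv : ∀ n, u (n + 1) + S.adjRestrict n (z • Θ (n + 1) z (u (n + 1))) =
      S.defect n (u n) := by
    intro n
    -- Guarantees that `Ring.inverse` is a genuine inverse and not its default value `0`.
    have hnorm : ‖S.adjRestrict n ∘L (z • Θ (n + 1) z)‖ < 1 := by
      refine (ContinuousLinearMap.opNorm_comp_le _ _).trans_lt ?_
      rw [norm_smul]
      have h1 := (hΘ (n + 1)).2 z hzb
      have h2 := S.norm_adjRestrict_le n
      have h3 : ‖z‖ * ‖Θ (n + 1) z‖ ≤ 1 / 2 * 1 := by gcongr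
      have h4 := mul_le_mul h2 h3 (by positivity) zero_le_one
      linarith
    have hunit := isUnit_one_add_of_norm_lt_one hnorm
    have h1 := congrArg (fun A : S.M (n + 1) →L[ℂ] S.M (n + 1) => A (S.defect n (u n)))
      (Ring.mul_inverse_cancel _ hunit)
    rw [hu n]
    exact h1
  have hrot : ∀ n, S.rot n (WithLp.toLp 2 (u n, z • Θ (n + 1) z (u (n + 1)))) =
      WithLp.toLp 2 (Θ n z (u n), u (n + 1)) := by
    intro n
    have h1 := congrArg (fun A : S.M n →L[ℂ] S.N n => A (u n)) (hstep n z hzb)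
    have h2 : Θ n z (u n) = S.Γ n (u n) + S.defectStar n (z • Θ (n + 1) z (u (n + 1))) := h1
    rw [rot_toLp, h2, ← hinv n, add_sub_cancel_right]
  obtain ⟨h, hh⟩ := S.exists_state_of_recursion (y := fun n => Θ n z (u n)) hz hrot fun n => by
    simpa using (Θ n z).le_of_opNorm_le ((hΘ n).2 z hzb) (u n)
  exact ⟨Θ 0 z x, h, h0 z hzb x, hh⟩

end ChoiceSequence

/-! ### The colligation of a contraction -/

section CharColligation

variable {H X Y : Type*} [NormedAddCommGroup H] [InnerProductSpace ℂ H] [CompleteSpace H]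
  [NormedAddCommGroup X] [InnerProductSpace ℂ X] [NormedAddCommGroup Y] [InnerProductSpace ℂ Y]

theorem norm_sq_rotation {T : H →L[ℂ] H} (hT : ‖T‖ ≤ 1) (x h : H) :
    ‖-T x + defectOp (ContinuousLinearMap.adjoint T) h‖ ^ 2 +
      ‖defectOp T x + ContinuousLinearMap.adjoint T h‖ ^ 2 = ‖x‖ ^ 2 + ‖h‖ ^ 2 := by
  have hT' : ‖ContinuousLinearMap.adjoint T‖ ≤ 1 := by simpa using hT
  have hx := defectOp_norm_sq hT x
  have hh := defectOp_norm_sq hT' h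
  have hc : (inner ℂ (T x) (defectOp (ContinuousLinearMap.adjoint T) h) : ℂ) =
      inner ℂ (defectOp T x) (ContinuousLinearMap.adjoint T h) := by
    rw [ContinuousLinearMap.adjoint_inner_right, apply_defectOp hT, inner_defectOp_left]
  rw [norm_add_sq (𝕜 := ℂ), norm_add_sq (𝕜 := ℂ), inner_neg_left, hc, norm_neg, map_neg]
  linarith

theorem rotation_mem {T : H →L[ℂ] H} (hT : ‖T‖ ≤ 1) {x : H} (hx : x ∈ defectSpace T) (h : H) :
    -T x + defectOp (ContinuousLinearMap.adjoint T) h ∈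
      defectSpace (ContinuousLinearMap.adjoint T) :=
  Submodule.add_mem _ (Submodule.neg_mem _ (apply_mem_defectSpace hT hx)) (defectOp_mem _ _)

theorem adjoint_rotation_mem {T : H →L[ℂ] H} (hT : ‖T‖ ≤ 1) {y : H}
    (hy : y ∈ defectSpace (ContinuousLinearMap.adjoint T)) (h : H) :
    -ContinuousLinearMap.adjoint T y + defectOp T h ∈ defectSpace T :=
  Submodule.add_mem _ (Submodule.neg_mem _ (adjoint_mem_defectSpace hT hy)) (defectOp_mem _ _)

/-- The unitary colligation `[-T, D_{T^*}; D_T, T^*] : 𝔇_T ⊕ H → 𝔇_{T^*} ⊕ H` of a contraction,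
with the outer spaces replaced by isometric copies. -/
def charColligation {T : H →L[ℂ] H} (hT : ‖T‖ ≤ 1) (eX : X ≃ₗᵢ[ℂ] defectSpace T)
    (eY : Y ≃ₗᵢ[ℂ] defectSpace (ContinuousLinearMap.adjoint T)) :
    WithLp 2 (X × H) ≃ₗᵢ[ℂ] WithLp 2 (Y × H) where
  toFun p := WithLp.toLp 2 (eY.symm ⟨_, rotation_mem hT (eX p.fst).2 p.snd⟩,
    defectOp T (eX p.fst) + ContinuousLinearMap.adjoint T p.snd)
  invFun q := WithLp.toLp 2 (eX.symm ⟨_, adjoint_rotation_mem hT (eY q.fst).2 q.snd⟩,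
    defectOp (ContinuousLinearMap.adjoint T) (eY q.fst) + T q.snd)
  map_add' p q := by
    refine congrArg (WithLp.toLp 2) (Prod.ext ?_ ?_)
    · change eY.symm _ = eY.symm _ + eY.symm _
      rw [← map_add]
      refine congrArg eY.symm (Subtype.ext ?_)
      simp
      abel
    · simp
      abel
  map_smul' c p := by
    refine congrArg (WithLp.toLp 2) (Prod.ext ?_ ?_)
    · change eY.symm _ = c • eY.symm _
      rw [← map_smul]
      refine congrArg eY.symm (Subtype.ext ?_)
      simp
    · simp
  -- The candidate inverse is the adjoint block matrix: diagonal entries collapse by `D_T² = I - T*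
  -- T` and its dual, off-diagonal ones by intertwining.
  left_inv p := by
    have hT' : ‖ContinuousLinearMap.adjoint T‖ ≤ 1 := by simpa using hT
    have h1 := apply_defectOp hT (eX p.fst : H)
    have h2 := apply_defectOp hT' p.snd
    have h3 := defectOp_defectOp hT (eX p.fst : H)
    have h4 := defectOp_defectOp hT' p.snd
    rw [ContinuousLinearMap.adjoint_adjoint] at h2 h4
    refine congrArg (WithLp.toLp 2) (Prod.ext ?_ ?_)
    · change eX.symm _ = p.fst
      rw [LinearIsometryEquiv.symm_apply_eq]
      refine Subtype.ext ?_
      simp [h2, h3]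
      abel
    · simp [h1, h4]
      abel
  right_inv q := by
    have hT' : ‖ContinuousLinearMap.adjoint T‖ ≤ 1 := by simpa using hT
    have h1 := apply_defectOp hT q.snd
    have h2 := apply_defectOp hT' (eY q.fst : H)
    have h3 := defectOp_defectOp hT q.snd
    have h4 := defectOp_defectOp hT' (eY q.fst : H)
    rw [ContinuousLinearMap.adjoint_adjoint] at h2 h4
    refine congrArg (WithLp.toLp 2) (Prod.ext ?_ ?_)
    · change eY.symm _ = q.fst
      rw [LinearIsometryEquiv.symm_apply_eq]
      refine Subtype.ext ?_
      simp [h1, h4]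
      abel
    · simp [h2, h3]
      abel
  norm_map' p := by
    rw [← sq_eq_sq₀ (norm_nonneg _) (norm_nonneg _), WithLp.prod_norm_sq_eq_of_L2]
    refine Eq.trans ?_ ((norm_sq_rotation hT (eX p.fst : H) p.snd).trans ?_)
    · exact congrArg (fun t : ℝ => t ^ 2 + _) (LinearIsometryEquiv.norm_map eY.symm _)
    · rw [WithLp.prod_norm_sq_eq_of_L2 p]
      exact congrArg (fun t : ℝ => t ^ 2 + _) (LinearIsometryEquiv.norm_map eX p.fst)

variable {T : H →L[ℂ] H} (hT : ‖T‖ ≤ 1) (eX : X ≃ₗᵢ[ℂ] defectSpace T)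
  (eY : Y ≃ₗᵢ[ℂ] defectSpace (ContinuousLinearMap.adjoint T))

theorem charColligation_toLp (x : X) (h : H) :
    charColligation hT eX eY (WithLp.toLp 2 (x, h)) =
      WithLp.toLp 2 (eY.symm ⟨_, rotation_mem hT (eX x).2 h⟩,
        defectOp T (eX x) + ContinuousLinearMap.adjoint T h) := rfl

theorem charColligation_symm_toLp (y : Y) (h : H) :
    (charColligation hT eX eY).symm (WithLp.toLp 2 (y, h)) =
      WithLp.toLp 2 (eX.symm ⟨_, adjoint_rotation_mem hT (eY y).2 h⟩,
        defectOp (ContinuousLinearMap.adjoint T) (eY y) + T h) := rfl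

theorem stateOp_charColligation :
    stateOp (charColligation hT eX eY) = ContinuousLinearMap.adjoint T := by
  ext h
  have := congrArg WithLp.snd (charColligation_toLp hT eX eY 0 h)
  simpa [colligation_state] using this

theorem stateOp_charColligation_symm : stateOp (charColligation hT eX eY).symm = T := by
  ext h
  have := congrArg WithLp.snd (charColligation_symm_toLp hT eX eY 0 h)
  simpa [colligation_state] using this

theorem coe_outputOp_charColligation (h : H) :
    (eY (outputOp (charColligation hT eX eY) h) : H) =
      defectOp (ContinuousLinearMap.adjoint T) h := by
  have := congrArg WithLp.fst (charColligation_toLp hT eX eY 0 h)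
  rw [colligation_state] at this
  have h2 := (LinearIsometryEquiv.eq_symm_apply _).1 this
  exact (congrArg Subtype.val h2).trans (by simp)

theorem coe_outputOp_charColligation_symm (h : H) :
    (eX (outputOp (charColligation hT eX eY).symm h) : H) = defectOp T h := by
  have := congrArg WithLp.fst (charColligation_symm_toLp hT eX eY 0 h)
  rw [colligation_state] at this
  have h2 := (LinearIsometryEquiv.eq_symm_apply _).1 this
  exact (congrArg Subtype.val h2).trans (by simp)

/-- The colligation of a completely non-unitary contraction is simple. -/
theorem isSimple_charColligation (hc : IsCompletelyNonUnitary T) :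
    IsSimple (charColligation hT eX eY) := by
  have hT' : ‖ContinuousLinearMap.adjoint T‖ ≤ 1 := by simpa using hT
  refine isSimple_of_forall_reducing _ fun L hL hA hA' hC hC' => ?_
  rw [stateOp_charColligation] at hA
  rw [stateOp_charColligation_symm] at hA'
  refine hc.eq_bot L hL hA' hA (fun x hx => ?_) (fun x hx => ?_)
  -- On a decoupled subspace `D_T` vanishes, so `T` is isometric there.
  · have h1 := coe_outputOp_charColligation_symm hT eX eY x
    rw [hC' x hx, map_zero, ZeroMemClass.coe_zero] at h1
    have h2 := defectOp_norm_sq hT x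
    rw [← h1, norm_zero] at h2
    rw [← sq_eq_sq₀ (norm_nonneg _) (norm_nonneg _)]
    linarith
  -- `D_{T*}` vanishes as well, so `T T* x = x` and `T* x` is a preimage inside the subspace.
  · have h1 := coe_outputOp_charColligation hT eX eY x
    rw [hC x hx, map_zero, ZeroMemClass.coe_zero] at h1
    have h2 := defectOp_defectOp hT' x
    rw [← h1, map_zero, ContinuousLinearMap.adjoint_adjoint] at h2
    exact ⟨_, hA x hx, (sub_eq_zero.1 h2.symm).symm⟩

/-- The characteristic function is the transfer function of the colligation. -/
theorem exists_state_charColligation {z : ℂ} (hz : ‖z‖ < 1) (x : X) :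
    ∃ h, charColligation hT eX eY (WithLp.toLp 2 (x, z • h)) =
      WithLp.toLp 2 (eY.symm (charFun T hT z (eX x)), h) := by
  have hT' : ‖ContinuousLinearMap.adjoint T‖ ≤ 1 := by simpa using hT
  have hunit : IsUnit (1 - z • ContinuousLinearMap.adjoint T) := by
    refine isUnit_one_sub_of_norm_lt_one ?_
    rw [norm_smul]
    have := mul_le_mul_of_nonneg_left hT' (norm_nonneg z)
    linarith
  set h := Ring.inverse (1 - z • ContinuousLinearMap.adjoint T) (defectOp T (eX x)) with hh
  have h1 : h - z • ContinuousLinearMap.adjoint T h = defectOp T (eX x) :=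
    congrArg (fun A : H →L[ℂ] H => A (defectOp T (eX x))) (Ring.mul_inverse_cancel _ hunit)
  refine ⟨h, ?_⟩
  rw [charColligation_toLp]
  refine congrArg (WithLp.toLp 2) (Prod.ext (congrArg eY.symm (Subtype.ext ?_)) ?_)
  · change -T (eX x) + defectOp (ContinuousLinearMap.adjoint T) (z • h) =
      -T (eX x) + z • defectOp (ContinuousLinearMap.adjoint T) h
    rw [map_smul]
  · change defectOp T (eX x) + ContinuousLinearMap.adjoint T (z • h) = h
    rw [map_smul, ← h1, sub_add_cancel]

end CharColligation

/-! ### Comparison of the two colligations -/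

/-- Unitary equivalence of the state operators of two colligations passes to their adjoints. -/
theorem UnitarilyEquivalent.stateOp_symm {X Y H K : Type*} [NormedAddCommGroup X]
    [InnerProductSpace ℂ X] [NormedAddCommGroup Y] [InnerProductSpace ℂ Y] [NormedAddCommGroup H]
    [InnerProductSpace ℂ H] [NormedAddCommGroup K] [InnerProductSpace ℂ K]
    {U : WithLp 2 (X × H) ≃ₗᵢ[ℂ] WithLp 2 (Y × H)} {V : WithLp 2 (X × K) ≃ₗᵢ[ℂ] WithLp 2 (Y × K)}
    (h : UnitarilyEquivalent (stateOp U) (stateOp V)) :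
    UnitarilyEquivalent (stateOp U.symm) (stateOp V.symm) := by
  obtain ⟨W, hW⟩ := h
  refine ⟨W, fun x => ext_inner_left ℂ fun k => ?_⟩
  obtain ⟨w, rfl⟩ := W.surjective k
  rw [W.inner_map_map, ← inner_stateOp_left, ← inner_stateOp_left, ← hW, W.inner_map_map]

/-- Both colligations have the values of the same function as outputs on `|z| < 1/2`. The isometries
`eX`, `eY` are needed because the outer spaces `M 0`, `N 0` of the CMV matrix are the top
submodules, not the defect spaces themselves. -/
theorem sameMarkov_charColligation_unitaryCMV {𝔐 𝔑 H : Type*} [NormedAddCommGroup 𝔐]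
    [InnerProductSpace ℂ 𝔐] [NormedAddCommGroup 𝔑] [InnerProductSpace ℂ 𝔑] [NormedAddCommGroup H]
    [InnerProductSpace ℂ H] [CompleteSpace H] {T : H →L[ℂ] H} (hT : ‖T‖ ≤ 1)
    {S : ChoiceSequence 𝔐 𝔑} {Φ : ℂ → 𝔐 →L[ℂ] 𝔑} (hS : S.IsSchurParameters Φ)
    (eX : S.M 0 ≃ₗᵢ[ℂ] defectSpace T)
    (eY : S.N 0 ≃ₗᵢ[ℂ] defectSpace (ContinuousLinearMap.adjoint T))
    (hΦ : ∀ z (x : S.M 0) (y : S.N 0), (y : 𝔑) = Φ z x → eY y = charFun T hT z (eX x)) :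
    SameMarkov (charColligation hT eX eY) S.unitaryCMV := by
  refine sameMarkov_of_transfer (r := 1 / 2) (by norm_num) fun z hz x => ?_
  obtain ⟨y, k, hy, hk⟩ := hS.exists_state hz.le x
  obtain ⟨h, hh⟩ := exists_state_charColligation hT eX eY (show ‖z‖ < 1 by linarith) x
  refine ⟨y, h, k, ?_, hk⟩
  rw [hh, ← hΦ z x y hy, LinearIsometryEquiv.symm_apply_apply]

/-- The colligations themselves compare `T*` with the truncated matrix of `{Γ n}`; their inverses
have `T` and the tilde matrix of `{Γ n*}` as state operators. -/
theorem unitarilyEquivalent_truncatedCMVTilde {H : Type*} [NormedAddCommGroup H]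
    [InnerProductSpace ℂ H] [CompleteSpace H] {T : H →L[ℂ] H} (hT : IsCompletelyNonUnitary T)
    (S : ChoiceSequence (defectSpace T) (defectSpace (ContinuousLinearMap.adjoint T)))
    (hS : S.IsSchurParameters (charFun T hT.contraction)) :
    UnitarilyEquivalent T S.adjoint.truncatedCMVTilde := by
  have hM := sameMarkov_charColligation_unitaryCMV hT.contraction hS
    (LinearIsometryEquiv.ofTop _ _ S.M_zero) (LinearIsometryEquiv.ofTop _ _ S.N_zero)
    (fun z x y h => h)
  have hE := (hM.unitarilyEquivalent (isSimple_charColligation hT.contraction _ _ hT)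
    S.isSimple_unitaryCMV).stateOp_symm
  rwa [stateOp_charColligation_symm, S.stateOp_unitaryCMV_symm] at hE

theorem ChoiceSequence.unitarilyEquivalent_truncatedCMV {𝔐 𝔑 H : Type*} [NormedAddCommGroup 𝔐]
    [InnerProductSpace ℂ 𝔐] [NormedAddCommGroup 𝔑] [InnerProductSpace ℂ 𝔑] [NormedAddCommGroup H]
    [InnerProductSpace ℂ H] (S : ChoiceSequence 𝔐 𝔑) {T : H →L[ℂ] H}
    (hT : UnitarilyEquivalent T S.truncatedCMVTilde) : UnitarilyEquivalent T S.truncatedCMV := by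
  obtain ⟨W, hW⟩ := hT
  refine ⟨W.trans S.unitaryV.symm, fun x => ?_⟩
  rw [LinearIsometryEquiv.trans_apply, LinearIsometryEquiv.symm_apply_eq]
  have h1 := S.opV_truncatedCMV (S.unitaryV.symm (W x))
  have h2 : S.opV (S.unitaryV.symm (W x)) = W x := S.unitaryV.apply_symm_apply (W x)
  rw [h2] at h1
  exact (hW x).trans h1.symm

end BlockCMV
end

theorem theorem7p1 {H : Type*} [NormedAddCommGroup H] [InnerProductSpace ℂ H] [CompleteSpace H]
    [TopologicalSpace.SeparableSpace H] (T : H →L[ℂ] H) (hT : BlockCMV.IsCompletelyNonUnitary T)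
    (S : BlockCMV.ChoiceSequence (BlockCMV.defectSpace T)
      (BlockCMV.defectSpace (ContinuousLinearMap.adjoint T)))
    (hS : S.IsSchurParameters (BlockCMV.charFun T hT.contraction)) :
    BlockCMV.UnitarilyEquivalent T S.adjoint.truncatedCMV ∧
      BlockCMV.UnitarilyEquivalent T S.adjoint.truncatedCMVTilde := by
  have h := BlockCMV.unitarilyEquivalent_truncatedCMVTilde hT S hS
  exact ⟨S.adjoint.unitarilyEquivalent_truncatedCMV h, h⟩
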